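/- For $f\in L^2(\mathbb R)$ real-valued let $\widehat f(\xi)=\int_{\mathbb R} e^{-ix\xi}f(x)\,dx$ denote the ($L^2$) Fourier transform, and for $\sigma>0$ let $G^\sigma(\mathbb R)$ be the space of those $f$ with $e^{\sigma|\xi|}\widehat f(\xi)\in L^2(\mathbb R)$. For a $k$-multiplier $M:\mathbb R^k\to\mathbb C$ let $[M]_{sym}$ be its average over all permutations of the $k$ variables, and put $$\Lambda_k(M;u_1,\dots,u_k)=\int_{\xi_1+\dots+\xi_k=0}M(\xi_1,\dots,\xi_k)\,\widehat{u}_1(\xi_1)\cdots\widehat{u}_k(\xi_k),$$ where the hyperplane carries the measure $(2\pi)^{-(k-1)}\,d\xi_1\cdots d\xi_{k-1}$. Let $m(\xi)=\cosh(\sigma\xi)$ and let $I$ be the Fourier multiplier operator $\widehat{If}(\xi)=m(\xi)\widehat f(\xi)$. Put $\alpha_k=i(\xi_1^3+\dots+\xi_k^3)$ and $$M_3=-i\,[m(\xi_1)\,m(\xi_2+\xi_3)\,(\xi_2+\xi_3)]_{sym},\qquad \beta_3=-\frac{M_3}{\alpha_3},$$ $$M_4=-\tfrac{3}{2}i\,[\beta_3(\xi_1,\xi_2,\xi_3+\xi_4)\,(\xi_3+\xi_4)]_{sym},\qquad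 \beta_4=-\frac{M_4}{\alpha_4}$$ (the quotients are defined almost everywhere on the respective hyperplanes). For a real-valued function $u(t,x)$ define, at each time $t$ with $u(t)\in G^\sigma(\mathbb R)$, the modified energies $$E_I^2(t)=\|Iu(t)\|_{L^2}^2,\qquad E_I^3(t)=E_I^2(t)+\Lambda_3(\beta_3;u(t),u(t),u(t)),$$ $$E_I^4(t)=E_I^3(t)+\Lambda_4(\beta_4;u(t),u(t),u(t),u(t)).$$ **Lemma 4.1.** There is an absolute constant $C>0$ such that for every $0<\sigma\le 1$, every real-valued $u$ (in particular every solution of the KdV equation $u_t+u_{xxx}+uu_x=0$) and every $t\in\mathbb R$ with $u(t)\in G^\sigma(\mathbb R)$, the integrals defining $\Lambda_3(\beta_3;u(t),u(t),u(t))$ and $\Lambda_4(\beta_4;u(t),u(t),u(t),u(t))$ converge absolutely and $$|E_I^4(t)-E_I^2(t)|\le C\left(\|Iu(t)\|_{L^2}^3+\|Iu(t)\|_{L^2}^4\right).$$ -/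

import Mathlib

open MeasureTheory
open scoped FourierTransform

noncomputable section

namespace KdVEnergy

/-! ### Fourier transform, Gevrey spaces and Fourier multipliers on the real line -/

/-- A real square-integrable function, regarded as a complex one. -/
def complexify (f : Lp ℝ 2 (volume : Measure ℝ)) : Lp ℂ 2 (volume : Measure ℝ) :=
  Complex.ofRealCLM.compLp f

/-- The (Plancherel) Fourier transform of a real `L²` function in the normalization
`f̂(ξ) = ∫ e^{-ixξ} f(x) dx`. Mathlib's transform `𝓕` is normalized as `∫ e^{-2πixξ} f(x) dx`, so
that `f̂(ξ) = (𝓕 f)(ξ / 2π)`. -/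
def hat (f : Lp ℝ 2 (volume : Measure ℝ)) : ℝ → ℂ := fun ξ =>
  (𝓕 (complexify f) : Lp ℂ 2 (volume : Measure ℝ)) (ξ / (2 * Real.pi))

/-- Membership in the Gevrey space `G^σ(ℝ)`: `e^{σ|ξ|} f̂(ξ)` is square-integrable. -/
def MemGevrey (σ : ℝ) (f : Lp ℝ 2 (volume : Measure ℝ)) : Prop :=
  MemLp (fun ξ : ℝ => (Real.exp (σ * |ξ|) : ℂ) * hat f ξ) 2 volume

open Classical in
/-- The Fourier multiplier operator `I` with symbol `m`, i.e. `(I f)^(ξ) = m(ξ) f̂(ξ)`. It is written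
in Mathlib's frequency variable `η = ξ / 2π`. The domain of `I` consists of the `f` for which
`m f̂` is square-integrable; outside the domain the value is set to `0`. -/
def multiplierOp (m : ℝ → ℝ) (f : Lp ℝ 2 (volume : Measure ℝ)) : Lp ℂ 2 (volume : Measure ℝ) :=
  if h : MemLp (fun η : ℝ => (m (2 * Real.pi * η) : ℂ) *
      (𝓕 (complexify f) : Lp ℂ 2 (volume : Measure ℝ)) η) 2 volume
  then 𝓕⁻ (h.toLp _) else 0

/-! ### Multilinear forms -/

/-- The symmetrization of a `k`-multiplier. -/
def sym {k : ℕ} (M : (Fin k → ℝ) → ℂ) : (Fin k → ℝ) → ℂ := fun ξ =>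
  ((k.factorial : ℂ))⁻¹ * ∑ τ : Equiv.Perm (Fin k), M (fun j => ξ (τ j))

/-- The point `(ξ₁, …, ξₙ, -(ξ₁ + ⋯ + ξₙ))` of the hyperplane `ξ₁ + ⋯ + ξₙ₊₁ = 0`. -/
def hyperplanePoint {n : ℕ} (ξ : Fin n → ℝ) : Fin (n + 1) → ℝ :=
  Fin.snoc (α := fun _ => ℝ) ξ (-∑ i, ξ i)

/-- The integrand of the `(n+1)`-form generated by the multiplier `M`, on the hyperplane
parametrized by its first `n` coordinates. -/
def formIntegrand {n : ℕ} (M : (Fin (n + 1) → ℝ) → ℂ)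
    (u : Fin (n + 1) → Lp ℝ 2 (volume : Measure ℝ)) (ξ : Fin n → ℝ) : ℂ :=
  M (hyperplanePoint ξ) * ∏ j, hat (u j) (hyperplanePoint ξ j)

/-- The `(n+1)`-linear functional `Λ(M; u₁, …, uₙ₊₁)`: the integral of `M û₁ ⋯ ûₙ₊₁` over the
hyperplane `ξ₁ + ⋯ + ξₙ₊₁ = 0` with respect to `(2π)⁻ⁿ dξ₁ ⋯ dξₙ`. With this normalization
`Λ(1; u₁, …, uₙ₊₁) = ∫ u₁ ⋯ uₙ₊₁ dx`. -/
def Lam {n : ℕ} (M : (Fin (n + 1) → ℝ) → ℂ)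
    (u : Fin (n + 1) → Lp ℝ 2 (volume : Measure ℝ)) : ℂ :=
  (((2 * Real.pi) ^ n : ℝ) : ℂ)⁻¹ * ∫ ξ : Fin n → ℝ, formIntegrand M u ξ

/-! ### Correction multipliers and modified energies -/

/-- `α_k = i (ξ₁³ + ⋯ + ξ_k³)`. -/
def alpha {k : ℕ} (ξ : Fin k → ℝ) : ℂ := Complex.I * ((∑ j, ξ j ^ 3 : ℝ) : ℂ)

/-- `M₃ = -i [m(ξ₁) m(ξ₂ + ξ₃) (ξ₂ + ξ₃)]_sym`. -/
def M₃ (m : ℝ → ℝ) (ξ : Fin 3 → ℝ) : ℂ :=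
  -Complex.I * sym (k := 3) (fun ζ => ((m (ζ 0) * m (ζ 1 + ζ 2) * (ζ 1 + ζ 2) : ℝ) : ℂ)) ξ

/-- `β₃ = -M₃ / α₃`. -/
def β₃ (m : ℝ → ℝ) (ξ : Fin 3 → ℝ) : ℂ := -(M₃ m ξ / alpha ξ)

/-- `M₄ = -(3/2) i [β₃(ξ₁, ξ₂, ξ₃ + ξ₄) (ξ₃ + ξ₄)]_sym`. -/
def M₄ (m : ℝ → ℝ) (ξ : Fin 4 → ℝ) : ℂ :=
  -Complex.I * (3 / 2) *
    sym (k := 4) (fun ζ => β₃ m ![ζ 0, ζ 1, ζ 2 + ζ 3] * ((ζ 2 + ζ 3 : ℝ) : ℂ)) ξ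

/-- `β₄ = -M₄ / α₄`. -/
def β₄ (m : ℝ → ℝ) (ξ : Fin 4 → ℝ) : ℂ := -(M₄ m ξ / alpha ξ)

/-- `E_I²(t) = ‖I u(t)‖²` (norm in `L²`). -/
def energy₂ (m : ℝ → ℝ) (u : ℝ → Lp ℝ 2 (volume : Measure ℝ)) (t : ℝ) : ℝ :=
  ‖multiplierOp m (u t)‖ ^ 2

/-- `E_I³(t) = E_I²(t) + Λ₃(β₃; u(t), u(t), u(t))`. -/
def energy₃ (m : ℝ → ℝ) (u : ℝ → Lp ℝ 2 (volume : Measure ℝ)) (t : ℝ) : ℂ :=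
  (energy₂ m u t : ℂ) + Lam (n := 2) (β₃ m) (fun _ => u t)

/-- `E_I⁴(t) = E_I³(t) + Λ₄(β₄; u(t), u(t), u(t), u(t))`. -/
def energy₄ (m : ℝ → ℝ) (u : ℝ → Lp ℝ 2 (volume : Measure ℝ)) (t : ℝ) : ℂ :=
  energy₃ m u t + Lam (n := 3) (β₄ m) (fun _ => u t)

/-- The symbol `m(ξ) = cosh(σξ) = (e^{σξ} + e^{-σξ}) / 2`. -/
def coshSymbol (σ : ℝ) : ℝ → ℝ := fun ξ => Real.cosh (σ * ξ)

end KdVEnergy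

end

/-!
The difference of the energies is `Λ₃(β₃) + Λ₄(β₄)`, so two multilinear forms have to be bounded.

*From multipliers to forms.* If `G = m |û|`, then `‖G‖₂` is `‖I u‖₂` up to a constant
(`lintegral_weightedHat_sq`). Once a `k`-multiplier divided by `m(ξ₁) ⋯ m(ξ_k)` is bounded by
`(1 + |ξ₁|)⁻¹ ⋯ (1 + |ξ_{k-2}|)⁻¹`, each of these weights makes one factor `G` integrable by
Cauchy–Schwarz, the last two factors are paired in `L²`, and the form is at most a constant times
`‖I u‖₂ ^ k` (`integrable_and_norm_Lam_le`).

*The multipliers.* Since `ξ m(ξ)² = ξ / 2 + f(2σξ) / (4σ)` with `f(x) = x cosh x`, and the linear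
part drops out on the hyperplane, in the variables `x = 2σξ` the multiplier `β₃` is a multiple of
`(f(x₁) + f(x₂) + f(x₃)) / (x₁ x₂ x₃)`, and `β₄` one of `N / D`, where
`N = ∑_{i<j} (f(xᵢ) + f(xⱼ) - f(xᵢ + xⱼ)) xₖ xₗ` and `D` is the product of the seven linear forms
`x₁, …, x₄, x₁ + x₂, x₁ + x₃, x₂ + x₃`. The numerator vanishes on the zero set of each form, so the
quotient is entire, and it is enough to bound it at complex points where no form is small. There it
is estimated term by term: `N / D` is the sum of the terms
`cosh(xᵢ) (∑_{j≠i} 1 / xⱼ) / ((x₁ + x₂) (x₁ + x₃) (x₂ + x₃))` and of the three terms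
`cosh(xᵢ + xⱼ) / (x₁ x₂ x₃ x₄)`. With `s = (|x₁| + ⋯ + |x₄|) / 2` each of them is at most a multiple
of `e^s / (1 + s)²`, because at least two of the forms in each denominator are of size `s` unless
the numerator is much smaller than `e^s` (`exp_mul_sq_le_of_single`, `exp_mul_sq_le_of_pair`). The
passage to complex points uses a single complex line in a fixed generic direction: on it, the
quotient is an entire function of one variable, to which the maximum principle applies on a circle
that stays away from the finitely many zeros (`norm_le_of_forms`). The zeros have to be distinct,
which holds almost everywhere. Finally `e^s` is absorbed by the product of the `m(ξⱼ)`, and the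
powers of `σ` left over by the scaling are the ones needed to turn `(1 + s)⁻²` into
`(1 + |ξ₁|)⁻¹ (1 + |ξ₂|)⁻¹` for `σ ≤ 1` (`norm_β₃_le`, `norm_β₄_le`).
-/

namespace KdVEnergy

/-! ### Dividing an entire function by its zeros -/

theorem exists_differentiable_eq_prod_mul {ι : Type*} (s : Finset ι) (z : ι → ℂ)
    (hz : Function.Injective z) {F : ℂ → ℂ} (hF : Differentiable ℂ F)
    (h0 : ∀ i ∈ s, F (z i) = 0) :
    ∃ φ : ℂ → ℂ, Differentiable ℂ φ ∧ ∀ w, F w = (∏ i ∈ s, (w - z i)) * φ w := by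
  classical
  induction s using Finset.induction_on with
  | empty => exact ⟨F, hF, by simp⟩
  | insert a s ha ih =>
    obtain ⟨φ, hφ, hFφ⟩ := ih fun i hi => h0 i (Finset.mem_insert_of_mem hi)
    have hφa : φ (z a) = 0 := by
      have h := h0 a (Finset.mem_insert_self a s)
      rw [hFφ] at h
      refine (mul_eq_zero.1 h).resolve_left (Finset.prod_ne_zero_iff.2 fun i hi => ?_)
      exact sub_ne_zero.2 fun e => ha (hz e ▸ hi)
    refine ⟨dslope φ (z a), ?_, fun w => ?_⟩
    · rw [← differentiableOn_univ]
      exact (Complex.differentiableOn_dslope Filter.univ_mem).2 hφ.differentiableOn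
    · have h := sub_smul_dslope φ (z a) w
      rw [hφa, sub_zero, smul_eq_mul] at h
      rw [hFφ, Finset.prod_insert ha, ← h]
      ring

/-- If a real linear form takes the value `p` at a point and `v` on a direction, then it equals
`p + w v` at complex time `w` along that direction. Finitely many such forms admit a common radius,
bounded in terms of their number, on which none of them is small. -/
theorem exists_radius {ι : Type*} [Fintype ι] (p v : ι → ℝ) (hv : ∀ i, 1 ≤ |v i|) :
    ∃ r : ℝ, 0 < r ∧ r ≤ Fintype.card ι + 1 ∧ ∀ w : ℂ, ‖w‖ = r → ∀ i,
      1 + |p i| ≤ (2 * Fintype.card ι + 5) * ‖(p i : ℂ) + w * v i‖ := by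
  classical
  set n := Fintype.card ι
  -- each form excludes at most one of the `n + 1` integer radii `1, …, n + 1`
  have hex : ∃ k : Fin (n + 1), ∀ i, 1 / 2 ≤ |(|p i| / |v i|) - ((k : ℕ) + 1 : ℝ)| := by
    by_contra! hcon
    choose f hf using hcon
    have hinj : Function.Injective f := by
      intro k l hkl
      have h1 := hf k
      have h2 := hf l
      rw [hkl] at h1
      rw [abs_lt] at h1 h2
      have h3 : ((k : ℕ) : ℝ) < (l : ℕ) + 1 := by linarith
      have h4 : ((l : ℕ) : ℝ) < (k : ℕ) + 1 := by linarith
      norm_cast at h3 h4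
      ext
      omega
    have := Fintype.card_le_of_injective f hinj
    simp [n] at this
  obtain ⟨k, hk⟩ := hex
  have hkn : ((k : ℕ) : ℝ) ≤ n := by exact_mod_cast Nat.lt_succ_iff.1 k.2
  have hk0 : (0 : ℝ) ≤ (k : ℕ) := Nat.cast_nonneg _
  refine ⟨(k : ℕ) + 1, by positivity, by linarith, fun w hw i => ?_⟩
  have hvi : 0 < |v i| := lt_of_lt_of_le one_pos (hv i)
  have hlow : |(|p i| - ((k : ℕ) + 1) * |v i|)| ≤ ‖(p i : ℂ) + w * v i‖ := by
    have h := abs_norm_sub_norm_le (p i : ℂ) (-(w * v i))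
    rw [sub_neg_eq_add, norm_neg, norm_mul, hw, Complex.norm_real, Complex.norm_real] at h
    exact h
  refine le_trans ?_ (mul_le_mul_of_nonneg_left hlow (by positivity))
  set t := |p i| / |v i| with ht
  have hpt : |p i| = t * |v i| := by rw [ht]; field_simp
  have ht0 : 0 ≤ t := by positivity
  have hkey : 1 + t ≤ (2 * n + 5) * |t - ((k : ℕ) + 1)| := by
    have hki : 1 / 2 ≤ |t - ((k : ℕ) + 1 : ℝ)| := hk i
    rcases le_total t (n + 3 / 2) with h | h
    · nlinarith
    · have : t - (n + 1) ≤ |t - ((k : ℕ) + 1 : ℝ)| := le_trans (by linarith) (le_abs_self _)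
      have hn : (0 : ℝ) ≤ n := Nat.cast_nonneg _
      nlinarith
  have h2 : |(|p i| - ((k : ℕ) + 1) * |v i|)| = |t - ((k : ℕ) + 1)| * |v i| := by
    rw [hpt, ← sub_mul, abs_mul, abs_abs]
  rw [h2]
  calc 1 + |p i| ≤ (1 + t) * |v i| := by rw [hpt]; linarith [hv i]
    _ ≤ ((2 * n + 5) * |t - ((k : ℕ) + 1)|) * |v i| := by gcongr
    _ = _ := by ring

/-- An entire function that vanishes wherever one of the linear forms `p i + w v i` does, these
zeros being distinct, is controlled at the origin by the product of the forms, as soon as it is so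
at the points where no form is small. -/
theorem norm_le_of_forms {ι : Type*} [Fintype ι] {F : ℂ → ℂ} (hF : Differentiable ℂ F)
    (p v : ι → ℝ) (hv : ∀ i, 1 ≤ |v i|)
    (hpv : ∀ i j, i ≠ j → p i * v j - p j * v i ≠ 0)
    (hzero : ∀ i (w : ℂ), (p i : ℂ) + w * v i = 0 → F w = 0) {M : ℝ}
    (hM : ∀ w : ℂ, ‖w‖ ≤ Fintype.card ι + 1 →
      (∀ i, 1 + |p i| ≤ (2 * Fintype.card ι + 5) * ‖(p i : ℂ) + w * v i‖) →
      ‖F w‖ ≤ M * ∏ i, ‖(p i : ℂ) + w * v i‖) :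
    ‖F 0‖ ≤ M * ∏ i, |p i| := by
  obtain ⟨r, hr0, hr, hlow⟩ := exists_radius p v hv
  have hv0 : ∀ i, (v i : ℂ) ≠ 0 := fun i e => by
    have := hv i
    rw [Complex.ofReal_eq_zero.1 e, abs_zero] at this
    linarith
  have hinj : Function.Injective fun i => -((p i : ℂ) / v i) := by
    intro i j hij
    by_contra hne
    have h := neg_injective hij
    rw [div_eq_div_iff (hv0 i) (hv0 j)] at h
    exact hpv i j hne (sub_eq_zero.2 (by exact_mod_cast h))
  have hform : ∀ i (w : ℂ), (p i : ℂ) + w * v i = v i * (w - -((p i : ℂ) / v i)) := by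
    intro i w
    have := hv0 i
    field_simp
    ring
  obtain ⟨φ, hφ, hFφ⟩ := exists_differentiable_eq_prod_mul Finset.univ _ hinj hF
    fun i _ => hzero i _ (by rw [hform, sub_self, mul_zero])
  have hFψ : ∀ w, F w * ∏ i, (v i : ℂ) = (∏ i, ((p i : ℂ) + w * v i)) * φ w := by
    intro w
    rw [hFφ, Finset.prod_congr rfl fun i _ => hform i w, Finset.prod_mul_distrib]
    ring
  have hV : 0 < ∏ i, ‖(v i : ℂ)‖ := Finset.prod_pos fun i _ => norm_pos_iff.2 (hv0 i)
  have hφM : ‖φ 0‖ ≤ M * ∏ i, ‖(v i : ℂ)‖ := by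
    refine Complex.norm_le_of_forall_mem_frontier_norm_le (U := Metric.ball 0 r)
      Metric.isBounded_ball hφ.diffContOnCl (fun w hw => ?_) (subset_closure (by simpa using hr0))
    rw [frontier_ball _ hr0.ne', mem_sphere_zero_iff_norm] at hw
    have hb := hM w (hw.le.trans hr) (hlow w hw)
    have hP : 0 < ∏ i, ‖(p i : ℂ) + w * v i‖ := Finset.prod_pos fun i _ => by
      have h1 := hlow w hw i
      by_contra! h2
      have h3 : (2 * (Fintype.card ι : ℝ) + 5) * ‖(p i : ℂ) + w * v i‖ ≤ 0 :=
        mul_nonpos_of_nonneg_of_nonpos (by positivity) h2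
      linarith [abs_nonneg (p i)]
    have h := congrArg norm (hFψ w)
    rw [norm_mul, norm_mul, norm_prod, norm_prod] at h
    refine le_of_mul_le_mul_left ?_ hP
    rw [← h]
    calc ‖F w‖ * ∏ i, ‖(v i : ℂ)‖ ≤ (M * ∏ i, ‖(p i : ℂ) + w * v i‖) * ∏ i, ‖(v i : ℂ)‖ := by
          gcongr
      _ = _ := by ring
  have h := congrArg norm (hFψ 0)
  rw [norm_mul, norm_mul, norm_prod, norm_prod] at h
  simp only [zero_mul, add_zero, Complex.norm_real, Real.norm_eq_abs] at h
  simp only [Complex.norm_real, Real.norm_eq_abs] at hφM hV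
  refine le_of_mul_le_mul_right ?_ hV
  rw [h]
  calc (∏ i, |p i|) * ‖φ 0‖ ≤ (∏ i, |p i|) * (M * ∏ i, |v i|) := by gcongr
    _ = _ := by ring

/-- A nonzero linear form vanishes almost nowhere. -/
theorem ae_linear_form_ne_zero {n : ℕ} (c : Fin n → ℝ) (hc : c ≠ 0) :
    ∀ᵐ ξ : Fin n → ℝ, ∑ i, c i * ξ i ≠ 0 := by
  classical
  let f : (Fin n → ℝ) →ₗ[ℝ] ℝ := ∑ i, c i • LinearMap.proj i
  have hf : ∀ ξ, f ξ = ∑ i, c i * ξ i := fun ξ => by simp [f]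
  have hker : LinearMap.ker f ≠ ⊤ := by
    intro h
    apply hc
    ext i
    have h1 : f (Pi.single i 1) = 0 := by rw [LinearMap.ker_eq_top.1 h]; rfl
    rw [hf] at h1
    simpa [Pi.single_apply] using h1
  have := Measure.addHaar_submodule (volume : Measure (Fin n → ℝ)) _ hker
  rw [← compl_mem_ae_iff] at this
  filter_upwards [this] with ξ hξ
  rw [← hf]
  exact hξ

/-! ### The numerators of the correction multipliers -/

/-- The entire function `w cosh w`, the profile of `ξ m(ξ)²` up to scaling and a linear term. -/
noncomputable def wcosh (w : ℂ) : ℂ := w * Complex.cosh w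

@[simp] theorem wcosh_zero : wcosh 0 = 0 := by simp [wcosh]

@[simp] theorem wcosh_neg (w : ℂ) : wcosh (-w) = -wcosh w := by simp [wcosh]

theorem norm_cosh_le (w : ℂ) : ‖Complex.cosh w‖ ≤ Real.exp |w.re| := by
  have h1 : ‖Complex.exp w‖ ≤ Real.exp |w.re| := by
    rw [Complex.norm_exp]; exact Real.exp_le_exp.2 (le_abs_self _)
  have h2 : ‖Complex.exp (-w)‖ ≤ Real.exp |w.re| := by
    rw [Complex.norm_exp, Complex.neg_re]; exact Real.exp_le_exp.2 (neg_le_abs _)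
  have h3 : 2 * ‖Complex.cosh w‖ ≤ 2 * Real.exp |w.re| := by
    have h := congrArg norm (Complex.two_cosh (x := w))
    rw [norm_mul, Complex.norm_ofNat] at h
    rw [h]
    linarith [norm_add_le (Complex.exp w) (Complex.exp (-w))]
  linarith

/-- A complex displacement of bounded size costs only a constant factor in the exponential. -/
theorem norm_wcosh_line_le (p v : ℝ) (w : ℂ) {R : ℝ} (hR : ‖w‖ * |v| ≤ R) :
    ‖wcosh (p + w * v)‖ ≤ ‖(p : ℂ) + w * v‖ * (Real.exp R * Real.exp |p|) := by
  rw [wcosh, norm_mul]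
  refine mul_le_mul_of_nonneg_left ((norm_cosh_le _).trans ?_) (norm_nonneg _)
  rw [← Real.exp_add]
  refine Real.exp_le_exp.2 ?_
  have h1 : ((p : ℂ) + w * v).re = p + w.re * v := by simp
  have h2 : |w.re * v| ≤ R := by
    rw [abs_mul]
    exact (mul_le_mul_of_nonneg_right (Complex.abs_re_le_norm w) (abs_nonneg v)).trans hR
  rw [h1]
  linarith [abs_add_le p (w.re * v)]

/-- For `a + b + c = 0`, the numerator of `β₃` over the denominator `a b c`. -/
noncomputable def cubicNumerator (a b c : ℂ) : ℂ := wcosh a + wcosh b + wcosh c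

theorem cubicNumerator_eq_zero {a b c : ℂ} (h : a + b + c = 0)
    (h0 : a = 0 ∨ b = 0 ∨ c = 0) : cubicNumerator a b c = 0 := by
  obtain rfl : c = -(a + b) := by linear_combination h
  rw [cubicNumerator, wcosh_neg]
  obtain rfl | rfl | h0 := h0
  · simp
  · simp
  · obtain rfl : b = -a := by linear_combination -h0
    simp

/-- For `a + b + c + d = 0`, the numerator of `β₄` over the denominator
`a b c d (a + b) (a + c) (b + c)`. Writing it in this form pairs each hyperbolic term with the
factors of the denominator that it lacks. -/
noncomputable def quarticNumerator (a b c d : ℂ) : ℂ :=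
  wcosh a * (b * c + b * d + c * d) + wcosh b * (a * c + a * d + c * d) +
  wcosh c * (a * b + a * d + b * d) + wcosh d * (a * b + a * c + b * c) +
  wcosh (a + b) * ((a + c) * (b + c)) + wcosh (a + c) * ((a + b) * (b + c)) +
  wcosh (b + c) * ((a + b) * (a + c))

/-- On the hyperplane the quartic numerator is the sum over pairs `{i, j}` of
`(f(xᵢ) + f(xⱼ) - f(xᵢ + xⱼ)) xₖ xₗ`, `f = wcosh`. -/
theorem quarticNumerator_eq_sum_pairs {a b c d : ℂ} (h : a + b + c + d = 0) :
    quarticNumerator a b c d =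
      (wcosh a + wcosh b - wcosh (a + b)) * (c * d) +
      (wcosh a + wcosh c - wcosh (a + c)) * (b * d) +
      (wcosh a + wcosh d - wcosh (a + d)) * (b * c) +
      (wcosh b + wcosh c - wcosh (b + c)) * (a * d) +
      (wcosh b + wcosh d - wcosh (b + d)) * (a * c) +
      (wcosh c + wcosh d - wcosh (c + d)) * (a * b) := by
  have h1 : a + d = -(b + c) := by linear_combination h
  have h2 : b + d = -(a + c) := by linear_combination h
  have h3 : c + d = -(a + b) := by linear_combination h
  rw [h1, h2, h3, wcosh_neg, wcosh_neg, wcosh_neg, quarticNumerator]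
  obtain rfl : d = -(a + b + c) := by linear_combination h
  ring

theorem quarticNumerator_eq_zero {a b c d : ℂ} (h : a + b + c + d = 0)
    (h0 : a = 0 ∨ b = 0 ∨ c = 0 ∨ d = 0 ∨ a + b = 0 ∨ a + c = 0 ∨ b + c = 0) :
    quarticNumerator a b c d = 0 := by
  rw [quarticNumerator_eq_sum_pairs h]
  have key : ∀ x y : ℂ, x + y = 0 → wcosh x = -wcosh y := fun x y hxy => by
    rw [eq_neg_of_add_eq_zero_left hxy, wcosh_neg]
  have h1 := key (a + b) (c + d) (by linear_combination h)
  have h2 := key (a + c) (b + d) (by linear_combination h)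
  have h3 := key (a + d) (b + c) (by linear_combination h)
  obtain rfl | rfl | rfl | rfl | h0 | h0 | h0 := h0
  · simp
  · simp
  · simp
  · simp
  · obtain rfl : b = -a := by linear_combination h0
    obtain rfl : d = -c := by linear_combination h
    simp only [wcosh_neg, add_neg_cancel, wcosh_zero]
    linear_combination (-(a * c)) * h2 + a * c * h3
  · obtain rfl : c = -a := by linear_combination h0
    obtain rfl : d = -b := by linear_combination h
    simp only [wcosh_neg, add_neg_cancel, wcosh_zero]
    linear_combination (-(a * b)) * h1 + a * b * h3
  · obtain rfl : c = -b := by linear_combination h0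
    obtain rfl : d = -a := by linear_combination h
    simp only [wcosh_neg, add_neg_cancel, wcosh_zero]
    linear_combination (-(a * b)) * h1 + a * b * h2

/-! ### Exponential weights on the hyperplanes -/

theorem exp_mul_le_three {a b c : ℝ} (h : a + b + c = 0) :
    Real.exp |a| * (1 + (|a| + |b| + |c|) / 2) ≤
      Real.exp ((|a| + |b| + |c|) / 2) * ((1 + |b|) * (1 + |c|)) := by
  have ha : |a| ≤ |b| + |c| := by
    rw [show a = -(b + c) by linarith, abs_neg]; exact abs_add_le b c
  have hb := abs_nonneg b
  have hc := abs_nonneg c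
  refine mul_le_mul (Real.exp_le_exp.2 (by linarith)) (by nlinarith) (by positivity)
    (Real.exp_pos _).le

/-- On the hyperplane no coordinate exceeds the sum of the others, so that at least two of them are
large when one is. -/
theorem sq_le_prod_four {a b c d : ℝ} (h : a + b + c + d = 0) :
    (1 + (|a| + |b| + |c| + |d|) / 2) ^ 2 ≤
      (1 + |a|) * (1 + |b|) * (1 + |c|) * (1 + |d|) := by
  have tri : ∀ x y z t : ℝ, x + y + z + t = 0 → |x| ≤ |y| + |z| + |t| := by
    intro x y z t hx
    rw [show x = -(y + z + t) by linarith, abs_neg]; exact abs_add_three y z t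
  have ha := tri a b c d (by linarith)
  have hb := tri b a c d (by linarith)
  have hc := tri c a b d (by linarith)
  have hd := tri d a b c (by linarith)
  have hx := abs_nonneg a
  have hy := abs_nonneg b
  have hz := abs_nonneg c
  have ht := abs_nonneg d
  generalize |a| = x, |b| = y, |c| = z, |d| = t at *
  have h1 := mul_le_mul_of_nonneg_left ha hx
  have h2 := mul_le_mul_of_nonneg_left hb hy
  have h3 := mul_le_mul_of_nonneg_left hc hz
  have h4 := mul_le_mul_of_nonneg_left hd ht
  have e3 : 0 ≤ x * y * z + x * y * t + x * z * t + y * z * t + x * y * z * t := by positivity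
  nlinarith

/-- The weight of the terms `cosh(a + b) / (a b c d)`. -/
theorem exp_mul_sq_le_of_pair {a b c d : ℝ} (h : a + b + c + d = 0) :
    Real.exp |a + b| * (1 + (|a| + |b| + |c| + |d|) / 2) ^ 2 ≤
      Real.exp ((|a| + |b| + |c| + |d|) / 2) *
        ((1 + |a|) * (1 + |b|) * (1 + |c|) * (1 + |d|)) := by
  have h1 : |a + b| ≤ |c| + |d| := by
    rw [show a + b = -(c + d) by linarith, abs_neg]; exact abs_add_le c d
  refine mul_le_mul (Real.exp_le_exp.2 (by linarith [abs_add_le a b])) (sq_le_prod_four h)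
    (by positivity) (Real.exp_pos _).le

/-- The weight of the terms whose numerator is `cosh a`. Either `|a|` is well below `s`, so that the
exponential gain suffices, or two of the sums `a + b`, `a + c`, `a + d` are of size `|a|`. -/
theorem exp_mul_sq_le_of_single {a b c d : ℝ} (h : a + b + c + d = 0) :
    Real.exp |a| * (1 + (|a| + |b| + |c| + |d|) / 2) ^ 2 ≤
      36 * Real.exp ((|a| + |b| + |c| + |d|) / 2) *
        ((1 + |a + b|) * (1 + |a + c|) * (1 + |a + d|)) := by
  set s := (|a| + |b| + |c| + |d|) / 2 with hs
  have has : |a| ≤ s := by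
    have : |a| ≤ |b| + |c| + |d| := by
      rw [show a = -(b + c + d) by linarith, abs_neg]; exact abs_add_three b c d
    linarith
  obtain ⟨q, hq⟩ : ∃ q, s = |a| + q := ⟨s - |a|, by ring⟩
  have hq0 : 0 ≤ q := by linarith
  have hA := abs_nonneg a
  have h1 := abs_nonneg (a + b)
  have h2 := abs_nonneg (a + c)
  have h3 := abs_nonneg (a + d)
  have key : (1 + s) ^ 2 ≤ 36 * Real.exp q * ((1 + |a + b|) * (1 + |a + c|) * (1 + |a + d|)) := by
    rcases le_total |a| (2 * q) with hc | hc
    · have he := Real.quadratic_le_exp_of_nonneg hq0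
      have hP : 1 ≤ (1 + |a + b|) * (1 + |a + c|) * (1 + |a + d|) :=
        one_le_mul_of_one_le_of_one_le
          (one_le_mul_of_one_le_of_one_le (by linarith) (by linarith)) (by linarith)
      calc (1 + s) ^ 2 ≤ 36 * Real.exp q := by nlinarith
        _ ≤ _ := le_mul_of_one_le_right (by positivity) hP
    · -- any two of the three sums add up to at least `|a| - q`, so at most one of them is small
      have hpair : ∀ x y z : ℝ, a + x + y + z = 0 → |x| + |y| + |z| = |b| + |c| + |d| →
          |a| / 2 ≤ |a + x| + |a + y| := by
        intro x y z hx hsum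
        have hz : |a| - q ≤ |a - z| := by
          have hz0 : |z| ≤ |a| + |x| + |y| := by
            rw [show z = -(a + x + y) by linarith, abs_neg]; exact abs_add_three a x y
          have hxy : |a + z| ≤ |x| + |y| := by
            rw [show a + z = -(x + y) by linarith, abs_neg]; exact abs_add_le x y
          have : |a| + |z| ≤ |a + z| ∨ |a| + |z| ≤ |a - z| := by
            rcases le_total 0 a with ha | ha <;> rcases le_total 0 z with hz | hz
            · left; rw [abs_of_nonneg ha, abs_of_nonneg hz]; exact le_abs_self _
            · right; rw [abs_of_nonneg ha, abs_of_nonpos hz]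
              exact le_trans (by linarith) (le_abs_self (a - z))
            · right; rw [abs_of_nonpos ha, abs_of_nonneg hz]
              exact le_trans (by linarith) (neg_le_abs (a - z))
            · left; rw [abs_of_nonpos ha, abs_of_nonpos hz]
              exact le_trans (by linarith) (neg_le_abs (a + z))
          rcases this with h | h
          · linarith [abs_sub_abs_le_abs_sub a z]
          · linarith [abs_nonneg z]
        have := abs_add_le (a + x) (a + y)
        rw [show a + x + (a + y) = a - z by linarith] at this
        linarith
      have p1 := hpair b c d h rfl
      have p2 := hpair b d c (by linarith) (by ring)
      have p3 := hpair c d b (by linarith) (by ring)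
      have hP : (1 + |a| / 4) ^ 2 ≤ (1 + |a + b|) * (1 + |a + c|) * (1 + |a + d|) := by
        have two : ∀ x y z : ℝ, 0 ≤ x → |a| / 4 ≤ y → |a| / 4 ≤ z →
            (1 + |a| / 4) ^ 2 ≤ (1 + x) * ((1 + y) * (1 + z)) := fun x y z hx hy hz => by
          rw [sq]
          refine le_trans (b := (1 + y) * (1 + z))
            (mul_le_mul (by linarith) (by linarith) (by linarith) (by linarith)) ?_
          exact le_mul_of_one_le_left
            (mul_nonneg (by linarith) (by linarith)) (by linarith)
        rcases le_total (|a| / 4) |a + b| with h4 | h4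
        · rcases le_total (|a| / 4) |a + c| with h5 | h5
          · linarith [two _ _ _ h3 h4 h5]
          · linarith [two _ _ _ h2 h4 (show |a| / 4 ≤ |a + d| by linarith)]
        · linarith [two _ _ _ h1 (show |a| / 4 ≤ |a + c| by linarith)
            (show |a| / 4 ≤ |a + d| by linarith)]
      have he : 1 ≤ Real.exp q := Real.one_le_exp hq0
      calc (1 + s) ^ 2 ≤ 36 * 1 * (1 + |a| / 4) ^ 2 := by nlinarith
        _ ≤ _ := by gcongr
  rw [hq, Real.exp_add, ← hq]
  calc Real.exp |a| * (1 + s) ^ 2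
      ≤ Real.exp |a| * (36 * Real.exp q * ((1 + |a + b|) * (1 + |a + c|) * (1 + |a + d|))) := by
        gcongr
    _ = _ := by ring

/-! ### Bounds for the numerators -/

/-- The values at `(a, b, c)`, `a + b + c = 0`, of the factors of the denominator of `β₃`. -/
def cubicForms (a b c : ℝ) : Fin 3 → ℝ := ![a, b, c]

/-- The values at `(a, b, c, d)`, `a + b + c + d = 0`, of the factors of the denominator of `β₄`. -/
def quarticForms (a b c d : ℝ) : Fin 7 → ℝ := ![a, b, c, d, a + b, a + c, b + c]

/-- The point is not on any of the hyperplanes where two zeros along the direction `(1, 2, -3)`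
collide. -/
def CubicGeneric (a b c : ℝ) : Prop :=
  ∀ i j, i ≠ j →
    cubicForms a b c i * cubicForms 1 2 (-3) j - cubicForms a b c j * cubicForms 1 2 (-3) i ≠ 0

/-- The point is not on any of the hyperplanes where two zeros along the direction `(1, 2, 4, -7)`
collide. -/
def QuarticGeneric (a b c d : ℝ) : Prop :=
  ∀ i j, i ≠ j →
    quarticForms a b c d i * quarticForms 1 2 4 (-7) j -
      quarticForms a b c d j * quarticForms 1 2 4 (-7) i ≠ 0

theorem differentiable_wcosh : Differentiable ℂ wcosh := by
  unfold wcosh; fun_prop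

/-- The radius of the circle is at most `4`, so that no form moves by more than `12`, and
`11 = 2 * 3 + 5` is the constant of `norm_le_of_forms`. -/
theorem norm_cubicNumerator_le {a b c : ℝ} (h : a + b + c = 0) (hg : CubicGeneric a b c) :
    ‖cubicNumerator a b c‖ * (1 + (|a| + |b| + |c|) / 2) ≤
      (363 * Real.exp 12) * Real.exp ((|a| + |b| + |c|) / 2) * (|a| * |b| * |c|) := by
  set s := (|a| + |b| + |c|) / 2 with hs
  have hs0 : 0 ≤ s := by positivity
  set F : ℂ → ℂ := fun w => cubicNumerator (a + w * (1 : ℝ)) (b + w * (2 : ℝ)) (c + w * (-3 : ℝ))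
    with hF
  have hFd : Differentiable ℂ F := by
    have := differentiable_wcosh
    simp only [hF, cubicNumerator]
    fun_prop
  have hsum : ∀ w : ℂ, (a + w * (1 : ℝ)) + (b + w * (2 : ℝ)) + (c + w * (-3 : ℝ)) = 0 := by
    intro w
    have : (a : ℂ) + b + c = 0 := by exact_mod_cast h
    push_cast
    linear_combination this
  have hb := norm_le_of_forms hFd (cubicForms a b c) (cubicForms 1 2 (-3))
    (by intro i; fin_cases i <;> norm_num [cubicForms]) hg ?_
    (M := (363 * Real.exp 12) * Real.exp s / (1 + s)) ?_
  · rw [Fin.prod_univ_three] at hb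
    simp only [hF, cubicForms, zero_mul, add_zero, Matrix.cons_val] at hb
    rw [div_mul_eq_mul_div, le_div_iff₀ (by positivity)] at hb
    exact hb
  · intro i w hi
    refine cubicNumerator_eq_zero (hsum w) ?_
    fin_cases i <;> simp only [cubicForms, Fin.zero_eta, Fin.mk_one, Fin.reduceFinMk,
      Matrix.cons_val] at hi
    · exact Or.inl hi
    · exact Or.inr (Or.inl hi)
    · exact Or.inr (Or.inr hi)
  · intro w hw hl
    have hla := hl 0
    have hlb := hl 1
    have hlc := hl 2
    rw [Fin.prod_univ_three]
    simp only [cubicForms, Fintype.card_fin, Matrix.cons_val] at hw hla hlb hlc ⊢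
    have hw4 : ‖w‖ ≤ 4 := by norm_num at hw; exact hw
    have na := norm_wcosh_line_le a 1 w (R := 12) (by norm_num; linarith)
    have nb := norm_wcosh_line_le b 2 w (R := 12) (by norm_num; linarith)
    have nc := norm_wcosh_line_le c (-3) w (R := 12) (by norm_num; linarith)
    rw [div_mul_eq_mul_div, le_div_iff₀ (by positivity)]
    have ea := exp_mul_le_three h
    have eb := exp_mul_le_three (a := b) (b := a) (c := c) (by linarith)
    have ec := exp_mul_le_three (a := c) (b := a) (c := b) (by linarith)
    rw [show (|b| + |a| + |c|) / 2 = s by rw [hs]; ring] at eb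
    rw [show (|c| + |a| + |b|) / 2 = s by rw [hs]; ring] at ec
    rw [← hs] at ea
    have hnorm : ‖F w‖ ≤ ‖wcosh (a + w * (1 : ℝ))‖ + ‖wcosh (b + w * (2 : ℝ))‖ +
        ‖wcosh (c + w * (-3 : ℝ))‖ := norm_add₃_le
    generalize ‖wcosh (a + w * (1 : ℝ))‖ = wa at *
    generalize ‖wcosh (b + w * (2 : ℝ))‖ = wb at *
    generalize ‖wcosh (c + w * (-3 : ℝ))‖ = wc at *
    have key : ∀ x y z X Y Z W : ℝ, 0 ≤ X → 0 ≤ Y → 0 ≤ Z →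
        1 + |y| ≤ 11 * Y → 1 + |z| ≤ 11 * Z →
        W ≤ X * (Real.exp 12 * Real.exp |x|) →
        Real.exp |x| * (1 + s) ≤ Real.exp s * ((1 + |y|) * (1 + |z|)) →
        W * (1 + s) ≤ 121 * Real.exp 12 * Real.exp s * (X * Y * Z) := by
      intro x y z X Y Z W hX hY hZ h1 h2 h3 h4
      calc W * (1 + s) ≤ X * (Real.exp 12 * Real.exp |x|) * (1 + s) := by gcongr
        _ = X * Real.exp 12 * (Real.exp |x| * (1 + s)) := by ring
        _ ≤ X * Real.exp 12 * (Real.exp s * ((1 + |y|) * (1 + |z|))) := by gcongr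
        _ ≤ X * Real.exp 12 * (Real.exp s * ((11 * Y) * (11 * Z))) := by gcongr
        _ = _ := by ring
    norm_num only at hla hlb hlc
    have ka := key a b c _ _ _ _ (norm_nonneg _) (norm_nonneg _) (norm_nonneg _) hlb hlc na ea
    have kb := key b a c _ _ _ _ (norm_nonneg _) (norm_nonneg _) (norm_nonneg _) hla hlc nb eb
    have kc := key c a b _ _ _ _ (norm_nonneg _) (norm_nonneg _) (norm_nonneg _) hla hlb nc ec
    have := mul_le_mul_of_nonneg_right hnorm (show 0 ≤ 1 + s by positivity)
    linarith

/-- The forms take the values `1, 2, 4, -7, 3, 5, 6` on the direction `(1, 2, 4, -7)`; the radius of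
the circle is at most `8`, so that no form moves by more than `56`, and `19 = 2 * 7 + 5` is the
constant of `norm_le_of_forms`. -/
theorem norm_quarticNumerator_le {a b c d : ℝ} (h : a + b + c + d = 0)
    (hg : QuarticGeneric a b c d) :
    ‖quarticNumerator a b c d‖ * (1 + (|a| + |b| + |c| + |d|) / 2) ^ 2 ≤
      (4 * 57 * 36 * 19 ^ 3 + 3 * 19 ^ 4) * Real.exp 56 *
        Real.exp ((|a| + |b| + |c| + |d|) / 2) *
        (|a| * |b| * |c| * |d| * |a + b| * |a + c| * |b + c|) := by
  set s := (|a| + |b| + |c| + |d|) / 2 with hs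
  have hs0 : 0 ≤ s := by positivity
  set F : ℂ → ℂ := fun w => quarticNumerator (a + w * (1 : ℝ)) (b + w * (2 : ℝ))
    (c + w * (4 : ℝ)) (d + w * (-7 : ℝ)) with hF
  have hFd : Differentiable ℂ F := by
    have := differentiable_wcosh
    simp only [hF, quarticNumerator]
    fun_prop
  have hsum : ∀ w : ℂ, (a + w * (1 : ℝ)) + (b + w * (2 : ℝ)) + (c + w * (4 : ℝ)) +
      (d + w * (-7 : ℝ)) = 0 := by
    intro w
    have : (a : ℂ) + b + c + d = 0 := by exact_mod_cast h
    push_cast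
    linear_combination this
  have h12 : ∀ w : ℂ, (a + w * (1 : ℝ)) + (b + w * (2 : ℝ)) = ((a + b : ℝ) : ℂ) + w * (3 : ℝ) := by
    intro w; push_cast; ring
  have h13 : ∀ w : ℂ, (a + w * (1 : ℝ)) + (c + w * (4 : ℝ)) = ((a + c : ℝ) : ℂ) + w * (5 : ℝ) := by
    intro w; push_cast; ring
  have h23 : ∀ w : ℂ, (b + w * (2 : ℝ)) + (c + w * (4 : ℝ)) = ((b + c : ℝ) : ℂ) + w * (6 : ℝ) := by
    intro w; push_cast; ring
  have hv : quarticForms 1 2 4 (-7) = ![1, 2, 4, -7, 3, 5, 6] := by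
    unfold quarticForms; norm_num
  unfold QuarticGeneric at hg
  rw [hv] at hg
  have hb := norm_le_of_forms hFd (quarticForms a b c d) ![1, 2, 4, -7, 3, 5, 6]
    (by intro i; fin_cases i <;> norm_num) hg ?_
    (M := (4 * 57 * 36 * 19 ^ 3 + 3 * 19 ^ 4) * Real.exp 56 * Real.exp s / (1 + s) ^ 2) ?_
  · rw [Fin.prod_univ_seven] at hb
    simp only [hF, quarticForms, zero_mul, add_zero, Matrix.cons_val] at hb
    rw [div_mul_eq_mul_div, le_div_iff₀ (by positivity)] at hb
    exact hb
  · intro i w hi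
    refine quarticNumerator_eq_zero (hsum w) ?_
    rw [h12, h13, h23]
    fin_cases i <;> simp only [quarticForms, Fin.zero_eta, Fin.mk_one, Fin.reduceFinMk,
      Matrix.cons_val] at hi
    · exact Or.inl hi
    · exact Or.inr (Or.inl hi)
    · exact Or.inr (Or.inr (Or.inl hi))
    · exact Or.inr (Or.inr (Or.inr (Or.inl hi)))
    · exact Or.inr (Or.inr (Or.inr (Or.inr (Or.inl hi))))
    · exact Or.inr (Or.inr (Or.inr (Or.inr (Or.inr (Or.inl hi)))))
    · exact Or.inr (Or.inr (Or.inr (Or.inr (Or.inr (Or.inr hi)))))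
  · intro w hw hl
    have hla := hl 0
    have hlb := hl 1
    have hlc := hl 2
    have hld := hl 3
    have hlab := hl 4
    have hlac := hl 5
    have hlbc := hl 6
    rw [Fin.prod_univ_seven]
    simp only [quarticForms, Fintype.card_fin, Matrix.cons_val] at hw hla hlb hlc hld hlab hlac hlbc ⊢
    have hw8 : ‖w‖ ≤ 8 := by norm_num at hw; exact hw
    have na := norm_wcosh_line_le a 1 w (R := 56) (by norm_num; linarith)
    have nb := norm_wcosh_line_le b 2 w (R := 56) (by norm_num; linarith)
    have nc := norm_wcosh_line_le c 4 w (R := 56) (by norm_num; linarith)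
    have nd := norm_wcosh_line_le d (-7) w (R := 56) (by norm_num; linarith)
    have nab := norm_wcosh_line_le (a + b) 3 w (R := 56) (by norm_num; linarith)
    have nac := norm_wcosh_line_le (a + c) 5 w (R := 56) (by norm_num; linarith)
    have nbc := norm_wcosh_line_le (b + c) 6 w (R := 56) (by norm_num; linarith)
    rw [div_mul_eq_mul_div, le_div_iff₀ (by positivity)]
    have ea := exp_mul_sq_le_of_single h
    have eb := exp_mul_sq_le_of_single (a := b) (b := a) (c := c) (d := d) (by linarith)
    have ec := exp_mul_sq_le_of_single (a := c) (b := a) (c := b) (d := d) (by linarith)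
    have ed := exp_mul_sq_le_of_single (a := d) (b := a) (c := b) (d := c) (by linarith)
    have eab := exp_mul_sq_le_of_pair h
    have eac := exp_mul_sq_le_of_pair (a := a) (b := c) (c := b) (d := d) (by linarith)
    have ebc := exp_mul_sq_le_of_pair (a := b) (b := c) (c := a) (d := d) (by linarith)
    have perm : ∀ x y z t : ℝ, x + y + z + t = |a| + |b| + |c| + |d| →
        (x + y + z + t) / 2 = s := fun x y z t hx => by rw [hx]
    rw [← hs] at ea eab
    rw [perm _ _ _ _ (by ring)] at eb ec ed eac ebc
    have had : |a + d| = |b + c| := by rw [show a + d = -(b + c) by linarith, abs_neg]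
    have hbd : |b + d| = |a + c| := by rw [show b + d = -(a + c) by linarith, abs_neg]
    have hcd : |c + d| = |a + b| := by rw [show c + d = -(a + b) by linarith, abs_neg]
    rw [had] at ea
    rw [hbd, add_comm b a] at eb
    rw [hcd, add_comm c a, add_comm c b] at ec
    rw [add_comm d a, add_comm d b, add_comm d c, had, hbd, hcd] at ed
    set A : ℂ := a + w * (1 : ℝ) with hA
    set B : ℂ := b + w * (2 : ℝ) with hB
    set Cc : ℂ := c + w * (4 : ℝ) with hCc
    set D : ℂ := d + w * (-7 : ℝ) with hD
    set S : ℂ := ((a + b : ℝ) : ℂ) + w * (3 : ℝ) with hS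
    set T : ℂ := ((a + c : ℝ) : ℂ) + w * (5 : ℝ) with hT
    set U : ℂ := ((b + c : ℝ) : ℂ) + w * (6 : ℝ) with hU
    have hFw : F w = wcosh A * (B * Cc + B * D + Cc * D) + wcosh B * (A * Cc + A * D + Cc * D) +
        wcosh Cc * (A * B + A * D + B * D) + wcosh D * (A * B + A * Cc + B * Cc) +
        wcosh S * (T * U) + wcosh T * (S * U) + wcosh U * (S * T) := by
      simp only [hF, quarticNumerator]
      rw [h12, h13, h23]
    norm_num only at hla hlb hlc hld hlab hlac hlbc
    have single : ∀ (x y z t : ℝ) (X Y Z V P Q R : ℂ),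
        1 ≤ 19 * ‖Y‖ → 1 ≤ 19 * ‖Z‖ → 1 ≤ 19 * ‖V‖ →
        1 + |y| ≤ 19 * ‖P‖ → 1 + |z| ≤ 19 * ‖Q‖ → 1 + |t| ≤ 19 * ‖R‖ →
        ‖wcosh X‖ ≤ ‖X‖ * (Real.exp 56 * Real.exp |x|) →
        Real.exp |x| * (1 + s) ^ 2 ≤
          36 * Real.exp s * ((1 + |y|) * (1 + |z|) * (1 + |t|)) →
        ‖wcosh X * (Y * Z + Y * V + Z * V)‖ * (1 + s) ^ 2 ≤
          57 * 36 * 19 ^ 3 * Real.exp 56 * Real.exp s *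
            (‖X‖ * ‖Y‖ * ‖Z‖ * ‖V‖ * ‖P‖ * ‖Q‖ * ‖R‖) := by
      intro x y z t X Y Z V P Q R h1 h2 h3 h4 h5 h6 h7 h8
      have h9 : ‖Y * Z + Y * V + Z * V‖ ≤ 57 * (‖Y‖ * ‖Z‖ * ‖V‖) := by
        refine norm_add₃_le.trans ?_
        simp only [norm_mul]
        have i1 := mul_le_mul_of_nonneg_left h3 (mul_nonneg (norm_nonneg Y) (norm_nonneg Z))
        have i2 := mul_le_mul_of_nonneg_left h2 (mul_nonneg (norm_nonneg Y) (norm_nonneg V))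
        have i3 := mul_le_mul_of_nonneg_left h1 (mul_nonneg (norm_nonneg Z) (norm_nonneg V))
        linarith
      rw [norm_mul]
      calc ‖wcosh X‖ * ‖Y * Z + Y * V + Z * V‖ * (1 + s) ^ 2
          ≤ (‖X‖ * (Real.exp 56 * Real.exp |x|)) * (57 * (‖Y‖ * ‖Z‖ * ‖V‖)) * (1 + s) ^ 2 := by
            gcongr
        _ = 57 * Real.exp 56 * (‖X‖ * ‖Y‖ * ‖Z‖ * ‖V‖) * (Real.exp |x| * (1 + s) ^ 2) := by ring
        _ ≤ 57 * Real.exp 56 * (‖X‖ * ‖Y‖ * ‖Z‖ * ‖V‖) *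
            (36 * Real.exp s * ((1 + |y|) * (1 + |z|) * (1 + |t|))) := by gcongr
        _ ≤ 57 * Real.exp 56 * (‖X‖ * ‖Y‖ * ‖Z‖ * ‖V‖) *
            (36 * Real.exp s * ((19 * ‖P‖) * (19 * ‖Q‖) * (19 * ‖R‖))) := by gcongr
        _ = _ := by ring
    have pair : ∀ (x a b c d : ℝ) (X Y Z P Q R V : ℂ),
        1 + |a| ≤ 19 * ‖P‖ → 1 + |b| ≤ 19 * ‖Q‖ → 1 + |c| ≤ 19 * ‖R‖ → 1 + |d| ≤ 19 * ‖V‖ →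
        ‖wcosh X‖ ≤ ‖X‖ * (Real.exp 56 * Real.exp |x|) →
        Real.exp |x| * (1 + s) ^ 2 ≤
          Real.exp s * ((1 + |a|) * (1 + |b|) * (1 + |c|) * (1 + |d|)) →
        ‖wcosh X * (Y * Z)‖ * (1 + s) ^ 2 ≤
          19 ^ 4 * Real.exp 56 * Real.exp s *
            (‖P‖ * ‖Q‖ * ‖R‖ * ‖V‖ * ‖X‖ * ‖Y‖ * ‖Z‖) := by
      intro x a b c d X Y Z P Q R V h1 h2 h3 h4 h5 h6
      rw [norm_mul, norm_mul]
      calc ‖wcosh X‖ * (‖Y‖ * ‖Z‖) * (1 + s) ^ 2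
          ≤ (‖X‖ * (Real.exp 56 * Real.exp |x|)) * (‖Y‖ * ‖Z‖) * (1 + s) ^ 2 := by gcongr
        _ = Real.exp 56 * (‖X‖ * ‖Y‖ * ‖Z‖) * (Real.exp |x| * (1 + s) ^ 2) := by ring
        _ ≤ Real.exp 56 * (‖X‖ * ‖Y‖ * ‖Z‖) *
            (Real.exp s * ((1 + |a|) * (1 + |b|) * (1 + |c|) * (1 + |d|))) := by gcongr
        _ ≤ Real.exp 56 * (‖X‖ * ‖Y‖ * ‖Z‖) *
            (Real.exp s * ((19 * ‖P‖) * (19 * ‖Q‖) * (19 * ‖R‖) * (19 * ‖V‖))) := by gcongr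
        _ = _ := by ring
    have one : ∀ {x y : ℝ}, 1 + |x| ≤ y → 1 ≤ y := fun {x y} hx => by linarith [abs_nonneg x]
    have ka := single _ _ _ _ A B Cc D S T U (one hlb) (one hlc) (one hld) hlab hlac hlbc na ea
    have kb := single _ _ _ _ B A Cc D S U T (one hla) (one hlc) (one hld) hlab hlbc hlac nb eb
    have kc := single _ _ _ _ Cc A B D T U S (one hla) (one hlb) (one hld) hlac hlbc hlab nc ec
    have kd := single _ _ _ _ D A B Cc U T S (one hla) (one hlb) (one hlc) hlbc hlac hlab nd ed
    have kab := pair _ _ _ _ _ S T U A B Cc D hla hlb hlc hld nab eab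
    have kac := pair _ _ _ _ _ T S U A Cc B D hla hlc hlb hld nac eac
    have kbc := pair _ _ _ _ _ U S T B Cc A D hlb hlc hla hld nbc ebc
    have hsum7 : ∀ x₁ x₂ x₃ x₄ x₅ x₆ x₇ : ℂ, ‖x₁ + x₂ + x₃ + x₄ + x₅ + x₆ + x₇‖ ≤
        ‖x₁‖ + ‖x₂‖ + ‖x₃‖ + ‖x₄‖ + ‖x₅‖ + ‖x₆‖ + ‖x₇‖ := by
      intro x₁ x₂ x₃ x₄ x₅ x₆ x₇
      linarith [norm_add_le (x₁ + x₂ + x₃ + x₄ + x₅ + x₆) x₇,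
        norm_add_le (x₁ + x₂ + x₃ + x₄ + x₅) x₆, norm_add_le (x₁ + x₂ + x₃ + x₄) x₅,
        norm_add_le (x₁ + x₂ + x₃) x₄, norm_add_le (x₁ + x₂) x₃, norm_add_le x₁ x₂]
    rw [hFw]
    refine (mul_le_mul_of_nonneg_right (hsum7 _ _ _ _ _ _ _) (by positivity)).trans ?_
    linarith

/-! ### The correction multipliers on the hyperplanes -/

theorem sum_perm_three (g : Fin 3 → ℂ) :
    ∑ τ : Equiv.Perm (Fin 3), g (τ 0) = 2 * (g 0 + g 1 + g 2) := by
  have hc : ∀ i : Fin 3, (Finset.univ.filter fun τ : Equiv.Perm (Fin 3) => τ 0 = i).card = 2 := by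
    decide
  rw [← Finset.sum_fiberwise Finset.univ (fun τ : Equiv.Perm (Fin 3) => τ 0)]
  rw [Finset.sum_congr rfl fun i _ => Finset.sum_congr rfl fun τ hτ => by
    rw [(Finset.mem_filter.1 hτ).2]]
  simp only [Finset.sum_const, hc, Fin.sum_univ_three]
  simp only [nsmul_eq_mul]
  push_cast
  ring

set_option maxRecDepth 10000 in
theorem sum_perm_four (g : Fin 4 → Fin 4 → ℂ) :
    ∑ τ : Equiv.Perm (Fin 4), g (τ 0) (τ 1) =
      2 * (g 0 1 + g 0 2 + g 0 3 + g 1 0 + g 1 2 + g 1 3 +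
        g 2 0 + g 2 1 + g 2 3 + g 3 0 + g 3 1 + g 3 2) := by
  have hc : ∀ p : Fin 4 × Fin 4, (Finset.univ.filter fun τ : Equiv.Perm (Fin 4) =>
      (τ 0, τ 1) = p).card = if p.1 = p.2 then 0 else 2 := by
    decide
  rw [← Finset.sum_fiberwise Finset.univ (fun τ : Equiv.Perm (Fin 4) => (τ 0, τ 1))]
  rw [Finset.sum_congr rfl fun p _ => Finset.sum_congr rfl (g := fun _ => g p.1 p.2) fun τ hτ => by
    rw [← (Finset.mem_filter.1 hτ).2]]
  simp only [Finset.sum_const, hc, Fintype.sum_prod_type, Fin.sum_univ_four]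
  simp
  ring

theorem mul_coshSymbol_sq {σ : ℝ} (hσ : σ ≠ 0) (ξ : ℝ) :
    ((ξ * coshSymbol σ ξ ^ 2 : ℝ) : ℂ) = ξ / 2 + (4 * σ : ℂ)⁻¹ * wcosh (2 * σ * ξ) := by
  have h : (σ : ℂ) ≠ 0 := by exact_mod_cast hσ
  have h2 : Complex.cosh (2 * σ * ξ) = 2 * Complex.cosh (σ * ξ) ^ 2 - 1 := by
    rw [mul_assoc, Complex.cosh_two_mul, Complex.sinh_sq]
    ring
  simp only [coshSymbol, wcosh, h2]
  push_cast
  field_simp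
  ring

theorem β₃_coshSymbol {σ : ℝ} (hσ : σ ≠ 0) (ξ : Fin 3 → ℝ) (h : ξ 0 + ξ 1 + ξ 2 = 0) :
    β₃ (coshSymbol σ) ξ = -((36 * σ : ℂ)⁻¹ *
      (cubicNumerator (2 * σ * ξ 0) (2 * σ * ξ 1) (2 * σ * ξ 2) / (ξ 0 * ξ 1 * ξ 2))) := by
  have hσ' : (σ : ℂ) ≠ 0 := by exact_mod_cast hσ
  have hc : (ξ 0 : ℂ) + ξ 1 + ξ 2 = 0 := by exact_mod_cast h
  have hsym : M₃ (coshSymbol σ) ξ = Complex.I / 3 * ((4 * σ : ℂ)⁻¹ *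
      cubicNumerator (2 * σ * ξ 0) (2 * σ * ξ 1) (2 * σ * ξ 2)) := by
    have hτ : ∀ τ : Equiv.Perm (Fin 3),
        ((coshSymbol σ (ξ (τ 0)) * coshSymbol σ (ξ (τ 1) + ξ (τ 2)) * (ξ (τ 1) + ξ (τ 2)) : ℝ) : ℂ)
          = -((ξ (τ 0) * coshSymbol σ (ξ (τ 0)) ^ 2 : ℝ) : ℂ) := by
      intro τ
      have hs : ξ (τ 0) + ξ (τ 1) + ξ (τ 2) = 0 := by
        have := Equiv.sum_comp τ ξ
        rw [Fin.sum_univ_three, Fin.sum_univ_three, h] at this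
        exact this
      rw [show ξ (τ 1) + ξ (τ 2) = -ξ (τ 0) by linarith]
      rw [show coshSymbol σ (-ξ (τ 0)) = coshSymbol σ (ξ (τ 0)) by simp [coshSymbol]]
      push_cast
      ring
    rw [M₃, sym, Finset.sum_congr rfl fun τ _ => hτ τ,
      sum_perm_three (fun i => -((ξ i * coshSymbol σ (ξ i) ^ 2 : ℝ) : ℂ))]
    simp only [mul_coshSymbol_sq hσ, cubicNumerator]
    have h6 : ((Nat.factorial 3 : ℕ) : ℂ) = 6 := by norm_num [Nat.factorial]
    rw [h6]
    linear_combination (Complex.I / 6) * hc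
  have hα : alpha ξ = Complex.I * (3 * (ξ 0 * ξ 1 * ξ 2)) := by
    rw [alpha, Fin.sum_univ_three]
    push_cast
    rw [show (ξ 2 : ℂ) = -(ξ 0 + ξ 1) by linear_combination hc]
    ring
  rw [β₃, hsym, hα, mul_comm Complex.I (3 * _), div_mul_eq_mul_div, div_div,
    show (3 : ℂ) * (3 * ((ξ 0 : ℂ) * ξ 1 * ξ 2) * Complex.I) =
      Complex.I * (9 * ((ξ 0 : ℂ) * ξ 1 * ξ 2)) by ring,
    mul_div_mul_left _ _ Complex.I_ne_zero, mul_inv, mul_inv, mul_div_assoc', mul_comm (9 : ℂ),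
    ← div_div]
  ring

/-- All linear forms are assumed nonzero because `β₃` has the value `0` where its denominator
vanishes, which spoils the formula there. -/
theorem β₄_coshSymbol {σ : ℝ} (hσ : σ ≠ 0) (ξ : Fin 4 → ℝ) (h : ξ 0 + ξ 1 + ξ 2 + ξ 3 = 0)
    (h0 : ∀ i, ξ i ≠ 0) (h01 : ξ 0 + ξ 1 ≠ 0) (h02 : ξ 0 + ξ 2 ≠ 0) (h12 : ξ 1 + ξ 2 ≠ 0) :
    β₄ (coshSymbol σ) ξ = (1728 * σ ^ 3 : ℂ)⁻¹ *
      (quarticNumerator (2 * σ * ξ 0) (2 * σ * ξ 1) (2 * σ * ξ 2) (2 * σ * ξ 3) /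
        (ξ 0 * ξ 1 * ξ 2 * ξ 3 * (ξ 0 + ξ 1) * (ξ 0 + ξ 2) * (ξ 1 + ξ 2))) := by
  have hσ' : (σ : ℂ) ≠ 0 := by exact_mod_cast hσ
  have hc : (ξ 0 : ℂ) + ξ 1 + ξ 2 + ξ 3 = 0 := by exact_mod_cast h
  have hξ : ∀ i, (ξ i : ℂ) ≠ 0 := fun i => by exact_mod_cast h0 i
  have n01 : (ξ 0 : ℂ) + ξ 1 ≠ 0 := by exact_mod_cast h01
  have n02 : (ξ 0 : ℂ) + ξ 2 ≠ 0 := by exact_mod_cast h02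
  have n12 : (ξ 1 : ℂ) + ξ 2 ≠ 0 := by exact_mod_cast h12
  have hpair : ∀ i j, i ≠ j → ξ i + ξ j ≠ 0 := by
    have h03 : ξ 0 + ξ 3 ≠ 0 := fun e => h12 (by linarith)
    have h13 : ξ 1 + ξ 3 ≠ 0 := fun e => h02 (by linarith)
    have h23 : ξ 2 + ξ 3 ≠ 0 := fun e => h01 (by linarith)
    intro i j hij
    fin_cases i <;> fin_cases j <;>
      first
      | exact absurd rfl hij
      | assumption
      | (rw [add_comm]; assumption)
  set g : Fin 4 → Fin 4 → ℂ := fun i j => -((36 * σ : ℂ)⁻¹ *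
    ((wcosh (2 * σ * ξ i) + wcosh (2 * σ * ξ j) - wcosh (2 * σ * ξ i + 2 * σ * ξ j)) /
      (ξ i * ξ j))) with hg
  have hτ : ∀ τ : Equiv.Perm (Fin 4),
      β₃ (coshSymbol σ) ![ξ (τ 0), ξ (τ 1), ξ (τ 2) + ξ (τ 3)] * ((ξ (τ 2) + ξ (τ 3) : ℝ) : ℂ) =
        g (τ 0) (τ 1) := by
    intro τ
    have hs : ξ (τ 0) + ξ (τ 1) + ξ (τ 2) + ξ (τ 3) = 0 := by
      have := Equiv.sum_comp τ ξ
      rw [Fin.sum_univ_four, Fin.sum_univ_four, h] at this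
      exact this
    have hne : ((ξ (τ 0) : ℂ) + ξ (τ 1)) ≠ 0 := by
      exact_mod_cast hpair _ _ (τ.injective.ne (by decide))
    rw [show ξ (τ 2) + ξ (τ 3) = -(ξ (τ 0) + ξ (τ 1)) by linarith,
      β₃_coshSymbol hσ _ (by simp)]
    simp only [Matrix.cons_val, cubicNumerator, hg]
    push_cast
    rw [show (2 * (σ : ℂ) * -(ξ (τ 0) + ξ (τ 1))) = -(2 * σ * ξ (τ 0) + 2 * σ * ξ (τ 1)) by ring,
      wcosh_neg]
    have := hξ (τ 0)
    have := hξ (τ 1)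
    field_simp
    ring
  have hM : M₄ (coshSymbol σ) ξ = -Complex.I * (3 / 2) * ((24 : ℂ)⁻¹ *
      ∑ τ : Equiv.Perm (Fin 4), g (τ 0) (τ 1)) := by
    rw [← Finset.sum_congr rfl fun τ _ => hτ τ]
    have h24 : ((Nat.factorial 4 : ℕ) : ℂ) = 24 := by norm_num [Nat.factorial]
    rw [← h24]
    rfl
  have hα : alpha ξ = -(Complex.I * (3 * ((ξ 0 + ξ 1) * (ξ 0 + ξ 2) * (ξ 1 + ξ 2)))) := by
    rw [alpha, Fin.sum_univ_four]
    push_cast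
    rw [show (ξ 3 : ℂ) = -(ξ 0 + ξ 1 + ξ 2) by linear_combination hc]
    ring
  have hc2 : (2 * σ * ξ 0 : ℂ) + 2 * σ * ξ 1 + 2 * σ * ξ 2 + 2 * σ * ξ 3 = 0 := by
    linear_combination (2 * σ : ℂ) * hc
  have hgs : ∀ i j, g i j = g j i := by
    intro i j
    simp only [hg]
    rw [add_comm (wcosh (2 * σ * ξ i)), add_comm (2 * (σ : ℂ) * ξ i), mul_comm (ξ i : ℂ) (ξ j)]
  rw [β₄, hM, hα, sum_perm_four, quarticNumerator_eq_sum_pairs hc2, hgs 1 0, hgs 2 0, hgs 2 1,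
    hgs 3 0, hgs 3 1, hgs 3 2]
  simp only [hg]
  have i0 := hξ 0
  have i1 := hξ 1
  have i2 := hξ 2
  have i3 := hξ 3
  have hI := Complex.I_ne_zero
  generalize wcosh (2 * σ * ξ 0 + 2 * σ * ξ 1) = w01
  generalize wcosh (2 * σ * ξ 0 + 2 * σ * ξ 2) = w02
  generalize wcosh (2 * σ * ξ 0 + 2 * σ * ξ 3) = w03
  generalize wcosh (2 * σ * ξ 1 + 2 * σ * ξ 2) = w12
  generalize wcosh (2 * σ * ξ 1 + 2 * σ * ξ 3) = w13
  generalize wcosh (2 * σ * ξ 2 + 2 * σ * ξ 3) = w23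
  generalize wcosh (2 * σ * ξ 0) = w0
  generalize wcosh (2 * σ * ξ 1) = w1
  generalize wcosh (2 * σ * ξ 2) = w2
  generalize wcosh (2 * σ * ξ 3) = w3
  field_simp
  ring

theorem exp_le_two_mul_coshSymbol {σ : ℝ} (hσ : 0 < σ) (ξ : ℝ) :
    Real.exp (σ * |ξ|) ≤ 2 * coshSymbol σ ξ := by
  have h := Real.cosh_eq (σ * |ξ|)
  have h2 : coshSymbol σ ξ = Real.cosh (σ * |ξ|) := by
    rw [coshSymbol, ← Real.cosh_abs, abs_mul, abs_of_pos hσ]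
  rw [h2, h]
  linarith [Real.exp_pos (-(σ * |ξ|))]

theorem cubicGeneric_smul {t : ℝ} (ht : t ≠ 0) {a b c : ℝ} (h : CubicGeneric a b c) :
    CubicGeneric (t * a) (t * b) (t * c) := by
  have hf : ∀ i, cubicForms (t * a) (t * b) (t * c) i = t * cubicForms a b c i := by
    intro i; fin_cases i <;> simp [cubicForms]
  intro i j hij
  rw [hf, hf, mul_assoc, mul_assoc, ← mul_sub]
  exact mul_ne_zero ht (h i j hij)

theorem quarticGeneric_smul {t : ℝ} (ht : t ≠ 0) {a b c d : ℝ} (h : QuarticGeneric a b c d) :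
    QuarticGeneric (t * a) (t * b) (t * c) (t * d) := by
  have hf : ∀ i, quarticForms (t * a) (t * b) (t * c) (t * d) i = t * quarticForms a b c d i := by
    intro i; fin_cases i <;> simp [quarticForms, mul_add]
  intro i j hij
  rw [hf, hf, mul_assoc, mul_assoc, ← mul_sub]
  exact mul_ne_zero ht (h i j hij)

/-- Scaling leaves a factor `σ² / (1 + s)` with `s ≥ σ |ξ 0|`, which is at most `(1 + |ξ 0|)⁻¹` for
`σ ≤ 1`. -/
theorem norm_β₃_le {σ : ℝ} (hσ : 0 < σ) (hσ1 : σ ≤ 1) (ξ : Fin 3 → ℝ)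
    (h : ξ 0 + ξ 1 + ξ 2 = 0) (hg : CubicGeneric (ξ 0) (ξ 1) (ξ 2)) :
    ‖β₃ (coshSymbol σ) ξ‖ * (1 + |ξ 0|) ≤
      2 * (363 * Real.exp 12) * ∏ j, coshSymbol σ (ξ j) := by
  set K := 363 * Real.exp 12 with hK
  have hK0 : 0 < K := by positivity
  have h2 : 0 < 2 * σ := by positivity
  have hN := norm_cubicNumerator_le (a := 2 * σ * ξ 0) (b := 2 * σ * ξ 1) (c := 2 * σ * ξ 2)
    (by linear_combination 2 * σ * h) (cubicGeneric_smul h2.ne' hg)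
  push_cast at hN
  rw [← hK] at hN
  simp only [abs_mul, abs_of_pos h2] at hN
  rw [show (2 * σ * |ξ 0| + 2 * σ * |ξ 1| + 2 * σ * |ξ 2|) / 2 =
    σ * |ξ 0| + σ * |ξ 1| + σ * |ξ 2| by ring, Real.exp_add, Real.exp_add] at hN
  rw [β₃_coshSymbol hσ.ne' ξ h, norm_neg, norm_mul, norm_div, norm_inv, norm_mul, norm_mul, norm_mul]
  simp only [Complex.norm_real, Complex.norm_ofNat, Real.norm_eq_abs, abs_of_pos hσ]
  set n := ‖cubicNumerator (2 * σ * ξ 0) (2 * σ * ξ 1) (2 * σ * ξ 2)‖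
  set s := σ * |ξ 0| + σ * |ξ 1| + σ * |ξ 2| with hs
  have hs0 : 0 ≤ s := by positivity
  have e0 := exp_le_two_mul_coshSymbol hσ (ξ 0)
  have e1 := exp_le_two_mul_coshSymbol hσ (ξ 1)
  have e2 := exp_le_two_mul_coshSymbol hσ (ξ 2)
  rw [Fin.prod_univ_three]
  have m0 : 0 < coshSymbol σ (ξ 0) := Real.cosh_pos _
  have m1 : 0 < coshSymbol σ (ξ 1) := Real.cosh_pos _
  have m2 : 0 < coshSymbol σ (ξ 2) := Real.cosh_pos _
  set P := coshSymbol σ (ξ 0) * coshSymbol σ (ξ 1) * coshSymbol σ (ξ 2) with hP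
  have hP0 : 0 < P := by positivity
  have hE : Real.exp (σ * |ξ 0|) * Real.exp (σ * |ξ 1|) * Real.exp (σ * |ξ 2|) ≤ 8 * P := by
    calc _ ≤ (2 * coshSymbol σ (ξ 0)) * (2 * coshSymbol σ (ξ 1)) * (2 * coshSymbol σ (ξ 2)) := by
          gcongr
      _ = 8 * P := by rw [hP]; ring
  have hquot : n / (|ξ 0| * |ξ 1| * |ξ 2|) ≤ K * (8 * P) * (8 * σ ^ 3) / (1 + s) := by
    refine div_le_of_le_mul₀ (by positivity) (by positivity) ?_
    rw [div_mul_eq_mul_div, le_div_iff₀ (by positivity)]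
    refine hN.trans ?_
    calc _ ≤ K * (8 * P) * (2 * σ * |ξ 0| * (2 * σ * |ξ 1|) * (2 * σ * |ξ 2|)) := by gcongr
      _ = _ := by ring
  have hs1 : σ * (1 + |ξ 0|) ≤ 1 + s := by
    have h1 : 0 ≤ σ * |ξ 1| := by positivity
    have h2 : 0 ≤ σ * |ξ 2| := by positivity
    linarith
  calc (36 * σ)⁻¹ * (n / (|ξ 0| * |ξ 1| * |ξ 2|)) * (1 + |ξ 0|)
      ≤ (36 * σ)⁻¹ * (K * (8 * P) * (8 * σ ^ 3) / (1 + s)) * (1 + |ξ 0|) := by gcongr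
    _ = (64 / 36 * K * P * σ) * ((σ * (1 + |ξ 0|)) / (1 + s)) := by
        field_simp
        ring
    _ ≤ (64 / 36 * K * P * 1) * 1 := by
        gcongr
        exact div_le_one_of_le₀ hs1 (by positivity)
    _ ≤ 2 * K * P := by nlinarith [mul_pos hK0 hP0]

/-- Scaling leaves a factor `σ⁴ / (1 + s)²`, of which `σ²` serves to replace `1 + s` by `1 + |ξ 0|`
and by `1 + |ξ 1|`. -/
theorem norm_β₄_le {σ : ℝ} (hσ : 0 < σ) (hσ1 : σ ≤ 1) (ξ : Fin 4 → ℝ)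
    (h : ξ 0 + ξ 1 + ξ 2 + ξ 3 = 0) (h0 : ∀ i, ξ i ≠ 0) (h01 : ξ 0 + ξ 1 ≠ 0)
    (h02 : ξ 0 + ξ 2 ≠ 0) (h12 : ξ 1 + ξ 2 ≠ 0)
    (hg : QuarticGeneric (ξ 0) (ξ 1) (ξ 2) (ξ 3)) :
    ‖β₄ (coshSymbol σ) ξ‖ * ((1 + |ξ 0|) * (1 + |ξ 1|)) ≤
      2 * ((4 * 57 * 36 * 19 ^ 3 + 3 * 19 ^ 4) * Real.exp 56) * ∏ j, coshSymbol σ (ξ j) := by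
  set K := (4 * 57 * 36 * 19 ^ 3 + 3 * 19 ^ 4) * Real.exp 56 with hK
  have hK0 : 0 < K := by positivity
  have h2 : 0 < 2 * σ := by positivity
  have hN := norm_quarticNumerator_le (a := 2 * σ * ξ 0) (b := 2 * σ * ξ 1) (c := 2 * σ * ξ 2)
    (d := 2 * σ * ξ 3) (by linear_combination 2 * σ * h) (quarticGeneric_smul h2.ne' hg)
  push_cast at hN
  rw [← hK] at hN
  simp only [← mul_add] at hN
  simp only [abs_mul, abs_two, abs_of_pos hσ] at hN
  rw [show (2 * σ * |ξ 0| + 2 * σ * |ξ 1| + 2 * σ * |ξ 2| + 2 * σ * |ξ 3|) / 2 =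
    σ * |ξ 0| + σ * |ξ 1| + σ * |ξ 2| + σ * |ξ 3| by ring, Real.exp_add, Real.exp_add,
    Real.exp_add] at hN
  rw [β₄_coshSymbol hσ.ne' ξ h h0 h01 h02 h12, norm_mul, norm_div, norm_inv]
  have hden : ‖((ξ 0 : ℂ) * ξ 1 * ξ 2 * ξ 3 * (ξ 0 + ξ 1) * (ξ 0 + ξ 2) * (ξ 1 + ξ 2))‖ =
      |ξ 0| * |ξ 1| * |ξ 2| * |ξ 3| * |ξ 0 + ξ 1| * |ξ 0 + ξ 2| * |ξ 1 + ξ 2| := by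
    simp only [← Real.norm_eq_abs, ← Complex.norm_real]
    push_cast
    simp only [norm_mul]
  have hcoef : ‖(1728 * (σ : ℂ) ^ 3)‖ = 1728 * σ ^ 3 := by
    rw [norm_mul, norm_pow, Complex.norm_real, Complex.norm_ofNat, Real.norm_eq_abs,
      abs_of_pos hσ]
  rw [hden, hcoef]
  set n := ‖quarticNumerator (2 * σ * ξ 0) (2 * σ * ξ 1) (2 * σ * ξ 2) (2 * σ * ξ 3)‖
  set s := σ * |ξ 0| + σ * |ξ 1| + σ * |ξ 2| + σ * |ξ 3| with hs
  set Q := |ξ 0| * |ξ 1| * |ξ 2| * |ξ 3| * |ξ 0 + ξ 1| * |ξ 0 + ξ 2| * |ξ 1 + ξ 2| with hQ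
  have hs0 : 0 ≤ s := by positivity
  have e0 := exp_le_two_mul_coshSymbol hσ (ξ 0)
  have e1 := exp_le_two_mul_coshSymbol hσ (ξ 1)
  have e2 := exp_le_two_mul_coshSymbol hσ (ξ 2)
  have e3 := exp_le_two_mul_coshSymbol hσ (ξ 3)
  rw [Fin.prod_univ_four]
  have m0 : 0 < coshSymbol σ (ξ 0) := Real.cosh_pos _
  have m1 : 0 < coshSymbol σ (ξ 1) := Real.cosh_pos _
  have m2 : 0 < coshSymbol σ (ξ 2) := Real.cosh_pos _
  have m3 : 0 < coshSymbol σ (ξ 3) := Real.cosh_pos _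
  set P := coshSymbol σ (ξ 0) * coshSymbol σ (ξ 1) * coshSymbol σ (ξ 2) * coshSymbol σ (ξ 3)
    with hP
  have hP0 : 0 < P := by positivity
  have hE : Real.exp (σ * |ξ 0|) * Real.exp (σ * |ξ 1|) * Real.exp (σ * |ξ 2|) *
      Real.exp (σ * |ξ 3|) ≤ 16 * P := by
    calc _ ≤ (2 * coshSymbol σ (ξ 0)) * (2 * coshSymbol σ (ξ 1)) * (2 * coshSymbol σ (ξ 2)) *
          (2 * coshSymbol σ (ξ 3)) := by gcongr
      _ = 16 * P := by rw [hP]; ring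
  have hquot : n / Q ≤ K * (16 * P) * (128 * σ ^ 7) / (1 + s) ^ 2 := by
    refine div_le_of_le_mul₀ (by positivity) (by positivity) ?_
    rw [div_mul_eq_mul_div, le_div_iff₀ (by positivity)]
    refine hN.trans ?_
    calc _ ≤ K * (16 * P) * (2 * σ * |ξ 0| * (2 * σ * |ξ 1|) * (2 * σ * |ξ 2|) * (2 * σ * |ξ 3|) *
          (2 * σ * |ξ 0 + ξ 1|) * (2 * σ * |ξ 0 + ξ 2|) * (2 * σ * |ξ 1 + ξ 2|)) := by gcongr
      _ = _ := by rw [hQ]; ring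
  have hs2 : (σ * (1 + |ξ 0|)) * (σ * (1 + |ξ 1|)) ≤ (1 + s) ^ 2 := by
    have h0 : 0 ≤ σ * |ξ 0| := by positivity
    have h1 : 0 ≤ σ * |ξ 1| := by positivity
    have h2 : 0 ≤ σ * |ξ 2| := by positivity
    have h3 : 0 ≤ σ * |ξ 3| := by positivity
    rw [sq]
    exact mul_le_mul (by linarith) (by linarith) (by positivity) (by positivity)
  calc (1728 * σ ^ 3)⁻¹ * (n / Q) * ((1 + |ξ 0|) * (1 + |ξ 1|))
      ≤ (1728 * σ ^ 3)⁻¹ * (K * (16 * P) * (128 * σ ^ 7) / (1 + s) ^ 2) *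
          ((1 + |ξ 0|) * (1 + |ξ 1|)) := by gcongr
    _ = (32 / 27 * K * P * σ ^ 2) * ((σ * (1 + |ξ 0|)) * (σ * (1 + |ξ 1|)) / (1 + s) ^ 2) := by
        field_simp
        ring
    _ ≤ (32 / 27 * K * P * 1) * 1 := by
        gcongr
        · exact pow_le_one₀ hσ.le hσ1
        · exact div_le_one_of_le₀ hs2 (by positivity)
    _ ≤ 2 * K * P := by nlinarith [mul_pos hK0 hP0]

/-! ### Genericity almost everywhere -/

/-- Let `v` be the values on some direction of the linear forms with coefficients `L`. If
`Lᵢ vⱼ ≠ Lⱼ vᵢ` for `i ≠ j`, then at almost every point the zeros of the forms along that direction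
are distinct. -/
theorem ae_cross_ne_zero {n k : ℕ} (L : Fin k → Fin n → ℤ) (v : Fin k → ℤ)
    (hL : ∀ i j, i ≠ j → ∃ l, L i l * v j - L j l * v i ≠ 0) :
    ∀ᵐ ξ : Fin n → ℝ, ∀ i j, i ≠ j →
      (∑ l, (L i l : ℝ) * ξ l) * v j - (∑ l, (L j l : ℝ) * ξ l) * v i ≠ 0 := by
  refine ae_all_iff.2 fun i => ae_all_iff.2 fun j => ?_
  by_cases hij : i = j
  · simp [hij]
  obtain ⟨l, hl⟩ := hL i j hij
  have := ae_linear_form_ne_zero (fun l => ((L i l * v j - L j l * v i : ℤ) : ℝ)) fun e =>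
    hl (Int.cast_injective (α := ℝ) (by simpa using congrFun e l))
  filter_upwards [this] with ξ hξ _
  convert! hξ using 1
  rw [Finset.sum_mul, Finset.sum_mul, ← Finset.sum_sub_distrib]
  refine Finset.sum_congr rfl fun l _ => ?_
  push_cast
  ring

theorem ae_cubicGeneric : ∀ᵐ ξ : Fin 2 → ℝ, CubicGeneric (ξ 0) (ξ 1) (-(ξ 0 + ξ 1)) := by
  filter_upwards [ae_cross_ne_zero ![![1, 0], ![0, 1], ![-1, -1]] ![1, 2, -3] (by decide)]
    with ξ hξ i j hij
  have hf : ∀ i, cubicForms (ξ 0) (ξ 1) (-(ξ 0 + ξ 1)) i =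
      ∑ l, ((![![1, 0], ![0, 1], ![-1, -1]] : Fin 3 → Fin 2 → ℤ) i l : ℝ) * ξ l := by
    intro i
    rw [Fin.sum_univ_two]
    fin_cases i <;> (simp [cubicForms]; try ring)
  have hv : ∀ i, cubicForms 1 2 (-3) i = ((![1, 2, -3] : Fin 3 → ℤ) i : ℝ) := by
    intro i
    fin_cases i <;> simp [cubicForms]
  rw [hf, hf, hv, hv]
  exact hξ i j hij

theorem ae_quarticGeneric : ∀ᵐ ξ : Fin 3 → ℝ,
    QuarticGeneric (ξ 0) (ξ 1) (ξ 2) (-(ξ 0 + ξ 1 + ξ 2)) ∧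
      ∀ i, quarticForms (ξ 0) (ξ 1) (ξ 2) (-(ξ 0 + ξ 1 + ξ 2)) i ≠ 0 := by
  set L : Fin 7 → Fin 3 → ℤ := ![![1, 0, 0], ![0, 1, 0], ![0, 0, 1], ![-1, -1, -1], ![1, 1, 0],
    ![1, 0, 1], ![0, 1, 1]] with hL
  have hf : ∀ (ξ : Fin 3 → ℝ) i, quarticForms (ξ 0) (ξ 1) (ξ 2) (-(ξ 0 + ξ 1 + ξ 2)) i =
      ∑ l, (L i l : ℝ) * ξ l := by
    intro ξ i
    rw [Fin.sum_univ_three]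
    fin_cases i <;> (simp [quarticForms, hL]; try ring)
  have hv : ∀ i, quarticForms 1 2 4 (-7) i = ((![1, 2, 4, -7, 3, 5, 6] : Fin 7 → ℤ) i : ℝ) := by
    intro i
    fin_cases i <;> norm_num [quarticForms]
  have hne : ∀ᵐ ξ : Fin 3 → ℝ, ∀ i, ∑ l, (L i l : ℝ) * ξ l ≠ 0 := by
    refine ae_all_iff.2 fun i => ae_linear_form_ne_zero _ fun e => ?_
    have hex : ∀ i, ∃ l, L i l ≠ 0 := by decide
    obtain ⟨l, hl⟩ := hex i
    exact hl (Int.cast_injective (α := ℝ) (by simpa using congrFun e l))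
  filter_upwards [ae_cross_ne_zero L ![1, 2, 4, -7, 3, 5, 6] (by decide), hne] with ξ hξ hξ0
  refine ⟨fun i j hij => ?_, fun i => ?_⟩
  · rw [hf, hf, hv, hv]
    exact hξ i j hij
  · rw [hf]
    exact hξ0 i

/-! ### Multilinear integrals over hyperplanes -/

/-- The factors `W` are integrated out one at a time; the translation `c` makes the induction work. -/
theorem lintegral_hyperplane_le {W G : ℝ → ENNReal} (hW : Measurable W) (hG : Measurable G)
    (n : ℕ) (c : ℝ) :
    ∫⁻ ξ : Fin (n + 1) → ℝ, (∏ i : Fin n, W (ξ i.castSucc)) * G (ξ (Fin.last n)) *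
      G (c - ∑ i, ξ i) ≤ (∫⁻ x, W x) ^ n * ∫⁻ x, G x ^ 2 := by
  induction n generalizing c with
  | zero =>
    refine le_trans (le_of_eq ((volume_preserving_funUnique (Fin 1) ℝ).symm.lintegral_comp_emb
      (MeasurableEquiv.measurableEmbedding _) _).symm) ?_
    simp only [MeasurableEquiv.funUnique_symm_apply, uniqueElim_const, Finset.univ_eq_empty,
      Finset.prod_empty, one_mul, pow_zero, Finset.sum_const, Finset.card_univ, Fintype.card_fin,
      zero_add, one_smul]
    have hpt : ∀ x, G x * G (c - x) ≤ 2⁻¹ * (G x ^ 2 + G (c - x) ^ 2) := by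
      intro x
      have h2 : ∀ a b : ENNReal, 2 * a * b ≤ a ^ 2 + b ^ 2 := by
        have hle : ∀ a b : ENNReal, a ≤ b → 2 * a * b ≤ a ^ 2 + b ^ 2 := by
          intro a b hab
          obtain ⟨d, rfl⟩ := exists_add_of_le hab
          calc 2 * a * (a + d) ≤ 2 * a * (a + d) + d ^ 2 := le_self_add
            _ = a ^ 2 + (a + d) ^ 2 := by ring
        intro a b
        rcases le_total a b with hab | hab
        · exact hle a b hab
        · rw [mul_right_comm, add_comm]
          exact hle b a hab
      calc G x * G (c - x) = 2⁻¹ * (2 * G x * G (c - x)) := by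
            rw [mul_assoc 2, ← mul_assoc, ENNReal.inv_mul_cancel two_ne_zero ENNReal.ofNat_ne_top,
              one_mul]
        _ ≤ _ := by gcongr; exact h2 _ _
    calc ∫⁻ x, G x * G (c - x) ≤ ∫⁻ x, 2⁻¹ * (G x ^ 2 + G (c - x) ^ 2) := lintegral_mono hpt
      _ = 2⁻¹ * ((∫⁻ x, G x ^ 2) + ∫⁻ x, G x ^ 2) := by
        rw [lintegral_const_mul _ (by fun_prop), lintegral_add_left (by fun_prop),
          lintegral_sub_left_eq_self (fun x => G x ^ 2) c]
      _ = ∫⁻ x, G x ^ 2 := by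
        rw [← two_mul, ← mul_assoc, ENNReal.inv_mul_cancel two_ne_zero ENNReal.ofNat_ne_top,
          one_mul]
      _ ≤ _ := le_rfl
  | succ n ih =>
    rw [← (volume_preserving_piFinSuccAbove (fun _ : Fin (n + 2) => ℝ) 0).symm.lintegral_comp_emb
      (MeasurableEquiv.measurableEmbedding _)]
    rw [Measure.volume_eq_prod, lintegral_prod _ (by fun_prop)]
    have hin : ∀ x : ℝ, (∫⁻ y : Fin (n + 1) → ℝ, (∏ i : Fin (n + 1),
        W ((MeasurableEquiv.piFinSuccAbove (fun _ => ℝ) 0).symm (x, y) i.castSucc)) *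
          G ((MeasurableEquiv.piFinSuccAbove (fun _ => ℝ) 0).symm (x, y) (Fin.last (n + 1))) *
          G (c - ∑ i, (MeasurableEquiv.piFinSuccAbove (fun _ : Fin (n + 2) => ℝ) 0).symm (x, y) i))
        ≤ W x * ((∫⁻ x, W x) ^ n * ∫⁻ x, G x ^ 2) := by
      intro x
      refine le_trans (le_of_eq ?_) (mul_le_mul_right (ih (c - x)) (W x))
      rw [← lintegral_const_mul _ (by fun_prop)]
      refine lintegral_congr fun y => ?_
      simp only [MeasurableEquiv.piFinSuccAbove_symm_apply, Fin.insertNthEquiv_apply,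
        Fin.insertNth_zero']
      rw [Fin.prod_univ_succ, Fin.sum_univ_succ, Fin.castSucc_zero, Fin.cons_zero,
        ← Fin.succ_last, Fin.cons_succ]
      simp only [← Fin.succ_castSucc, Fin.cons_succ]
      rw [← sub_sub]
      ring
    refine (lintegral_mono hin).trans ?_
    rw [lintegral_mul_const _ hW, pow_succ]
    exact le_of_eq (by ring)

/-! ### The weighted Fourier transform -/

theorem measurable_hat (f : Lp ℝ 2 (volume : Measure ℝ)) : Measurable (hat f) :=
  (Lp.stronglyMeasurable _).measurable.comp (measurable_id.div_const _)

theorem measurable_coshSymbol (σ : ℝ) : Measurable (coshSymbol σ) := by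
  unfold coshSymbol; fun_prop

/-- The modulus of `m f̂`, the Fourier transform of `I f`. -/
noncomputable def weightedHat (σ : ℝ) (f : Lp ℝ 2 (volume : Measure ℝ)) (ξ : ℝ) : ENNReal :=
  ENNReal.ofReal (coshSymbol σ ξ) * ‖hat f ξ‖ₑ

theorem measurable_weightedHat (σ : ℝ) (f : Lp ℝ 2 (volume : Measure ℝ)) :
    Measurable (weightedHat σ f) :=
  (measurable_coshSymbol σ).ennreal_ofReal.mul (measurable_hat f).enorm

theorem lintegral_comp_div_two_pi (F : ℝ → ENNReal) (hF : Measurable F) :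
    ∫⁻ ξ, F (ξ / (2 * Real.pi)) = ENNReal.ofReal (2 * Real.pi) * ∫⁻ η, F η := by
  have hpi : (0 : ℝ) < 2 * Real.pi := by positivity
  conv_lhs => rw [← Real.smul_map_volume_mul_left hpi.ne']
  rw [lintegral_smul_measure, lintegral_map (by fun_prop) (by fun_prop), abs_of_pos hpi,
    smul_eq_mul]
  congr 1
  refine lintegral_congr fun η => ?_
  rw [mul_div_cancel_left₀ _ hpi.ne']

theorem lintegral_weightedHat_lt_top {σ : ℝ} (hσ : 0 < σ) {f : Lp ℝ 2 (volume : Measure ℝ)}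
    (hf : MemGevrey σ f) : ∫⁻ ξ, weightedHat σ f ξ ^ 2 < ⊤ := by
  have h := hf.2
  rw [eLpNorm_lt_top_iff_lintegral_rpow_enorm_lt_top two_ne_zero ENNReal.ofNat_ne_top] at h
  refine lt_of_le_of_lt (lintegral_mono fun ξ => ?_) h
  rw [ENNReal.toReal_ofNat, ENNReal.rpow_two, enorm_mul, weightedHat]
  gcongr
  have hle : coshSymbol σ ξ ≤ Real.exp (σ * |ξ|) := by
    rw [coshSymbol, ← Real.cosh_abs, abs_mul, abs_of_pos hσ, Real.cosh_eq]
    have : Real.exp (-(σ * |ξ|)) ≤ Real.exp (σ * |ξ|) :=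
      Real.exp_le_exp.2 (by have : 0 ≤ σ * |ξ| := by positivity
                            linarith)
    linarith
  rw [← ofReal_norm, Complex.norm_real, Real.norm_eq_abs, Real.abs_exp]
  exact ENNReal.ofReal_le_ofReal hle

/-- Plancherel's identity for `I f`, in the normalization of `hat`. -/
theorem lintegral_weightedHat_sq {σ : ℝ} (hσ : 0 < σ) {f : Lp ℝ 2 (volume : Measure ℝ)}
    (hf : MemGevrey σ f) : ∫⁻ ξ, weightedHat σ f ξ ^ 2 =
      ENNReal.ofReal (2 * Real.pi * ‖multiplierOp (coshSymbol σ) f‖ ^ 2) := by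
  set Φ : Lp ℂ 2 (volume : Measure ℝ) := 𝓕 (complexify f) with hΦ
  set g : ℝ → ℂ := fun η => (coshSymbol σ (2 * Real.pi * η) : ℂ) * Φ η with hg
  have hpi : (0 : ℝ) < 2 * Real.pi := by positivity
  have hgm : Measurable g := by
    have h1 := measurable_coshSymbol σ
    have h2 : Measurable Φ := (Lp.stronglyMeasurable _).measurable
    fun_prop
  have hscale : ∫⁻ ξ, weightedHat σ f ξ ^ 2 = ENNReal.ofReal (2 * Real.pi) * ∫⁻ η, ‖g η‖ₑ ^ 2 := by
    rw [← lintegral_comp_div_two_pi _ (by fun_prop)]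
    refine lintegral_congr fun ξ => ?_
    simp only [hg]
    rw [mul_div_cancel₀ _ hpi.ne', enorm_mul, weightedHat, ← ofReal_norm (coshSymbol σ ξ : ℂ),
      Complex.norm_real, Real.norm_eq_abs, abs_of_pos (show 0 < coshSymbol σ ξ from Real.cosh_pos _)]
    rfl
  have hnorm : eLpNorm g 2 volume ^ 2 = ∫⁻ η, ‖g η‖ₑ ^ 2 := by
    have := eLpNorm_nnreal_pow_eq_lintegral (f := g) (μ := volume) (p := 2) two_ne_zero
    simpa using this
  have hmem : MemLp g 2 volume := by
    refine ⟨hgm.aestronglyMeasurable, ?_⟩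
    have hfin := lintegral_weightedHat_lt_top hσ hf
    rw [hscale, ← hnorm] at hfin
    by_contra hcon
    rw [not_lt_top_iff.1 hcon, ENNReal.top_pow two_ne_zero,
      ENNReal.mul_top (ENNReal.ofReal_pos.2 hpi).ne'] at hfin
    exact lt_irrefl _ hfin
  have hI : ‖multiplierOp (coshSymbol σ) f‖ = (eLpNorm g 2 volume).toReal := by
    rw [multiplierOp, dif_pos hmem, ← Lp.norm_toLp g hmem]
    exact (Lp.fourierTransformₗᵢ ℝ ℂ).symm.norm_map _
  rw [hscale, ← hnorm, hI, ENNReal.ofReal_mul hpi.le, ENNReal.ofReal_pow ENNReal.toReal_nonneg,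
    ENNReal.ofReal_toReal hmem.2.ne]

/-- The Cauchy–Schwarz inequality that makes one decaying factor `(1 + |ξ|)⁻¹` integrable against
`m f̂`. -/
theorem lintegral_weightedHat_mul_le {σ : ℝ} (hσ : 0 < σ) {f : Lp ℝ 2 (volume : Measure ℝ)}
    (hf : MemGevrey σ f) :
    ∫⁻ ξ, ENNReal.ofReal (1 + |ξ|)⁻¹ * weightedHat σ f ξ ≤
      ENNReal.ofReal (2 * Real.pi * ‖multiplierOp (coshSymbol σ) f‖) := by
  set X := ‖multiplierOp (coshSymbol σ) f‖ with hX
  have hX0 : 0 ≤ X := norm_nonneg _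
  have hpi := Real.pi_pos
  have hw : ∫⁻ ξ : ℝ, ENNReal.ofReal (1 + |ξ|)⁻¹ ^ (2 : ℝ) ≤ ENNReal.ofReal Real.pi := by
    rw [← integral_univ_inv_one_add_sq, ofReal_integral_eq_lintegral_ofReal
      integrable_inv_one_add_sq (Filter.Eventually.of_forall fun x => by positivity)]
    refine lintegral_mono fun ξ => ?_
    rw [ENNReal.rpow_two, ← ENNReal.ofReal_pow (by positivity), inv_pow]
    refine ENNReal.ofReal_le_ofReal (inv_anti₀ (by positivity) ?_)
    nlinarith [abs_nonneg ξ, sq_abs ξ]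
  have h := ENNReal.lintegral_mul_le_Lp_mul_Lq volume Real.HolderConjugate.two_two
    (f := fun ξ : ℝ => ENNReal.ofReal (1 + |ξ|)⁻¹) (g := weightedHat σ f) (by fun_prop)
    (measurable_weightedHat σ f).aemeasurable
  refine h.trans ?_
  simp only [ENNReal.rpow_two] at hw ⊢
  rw [lintegral_weightedHat_sq hσ hf, ← hX]
  calc _ ≤ ENNReal.ofReal Real.pi ^ (1 / 2 : ℝ) *
        ENNReal.ofReal (2 * Real.pi * X ^ 2) ^ (1 / 2 : ℝ) := by gcongr
    _ = ENNReal.ofReal ((Real.pi * (2 * Real.pi * X ^ 2)) ^ (1 / 2 : ℝ)) := by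
      rw [← ENNReal.mul_rpow_of_nonneg _ _ (by norm_num), ← ENNReal.ofReal_mul hpi.le,
        ENNReal.ofReal_rpow_of_nonneg (by positivity) (by norm_num)]
    _ ≤ _ := by
      refine ENNReal.ofReal_le_ofReal ?_
      rw [← Real.sqrt_eq_rpow]
      refine Real.sqrt_le_iff.2 ⟨by positivity, ?_⟩
      nlinarith [mul_nonneg (sq_nonneg Real.pi) (sq_nonneg X)]

/-! ### Bounding the forms -/

theorem hyperplanePoint_castSucc {n : ℕ} (ξ : Fin n → ℝ) (i : Fin n) :
    hyperplanePoint ξ i.castSucc = ξ i := by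
  simp [hyperplanePoint]

theorem hyperplanePoint_last {n : ℕ} (ξ : Fin n → ℝ) :
    hyperplanePoint ξ (Fin.last n) = -∑ i, ξ i := by
  simp [hyperplanePoint]

theorem measurable_hyperplanePoint {n : ℕ} :
    Measurable (hyperplanePoint : (Fin n → ℝ) → Fin (n + 1) → ℝ) := by
  refine measurable_pi_iff.2 fun j => ?_
  refine Fin.lastCases ?_ (fun i => ?_) j
  · simp only [hyperplanePoint_last]; fun_prop
  · simp only [hyperplanePoint_castSucc]; fun_prop

theorem measurable_formIntegrand {n : ℕ} {M : (Fin (n + 1) → ℝ) → ℂ} (hM : Measurable M)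
    (u : Fin (n + 1) → Lp ℝ 2 (volume : Measure ℝ)) : Measurable (formIntegrand M u) := by
  unfold formIntegrand
  refine (hM.comp measurable_hyperplanePoint).mul (Finset.measurable_prod _ fun j _ => ?_)
  exact (measurable_hat _).comp ((measurable_pi_apply j).comp measurable_hyperplanePoint)

theorem lintegral_formIntegrand_le {n : ℕ} {σ : ℝ} (hσ : 0 < σ)
    {f : Lp ℝ 2 (volume : Measure ℝ)} (hf : MemGevrey σ f) {M : (Fin (n + 2) → ℝ) → ℂ} {K : ℝ}
    (hK : 0 ≤ K)
    (hM : ∀ᵐ ξ : Fin (n + 1) → ℝ,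
      ‖M (hyperplanePoint ξ)‖ * ∏ i : Fin n, (1 + |ξ i.castSucc|) ≤
        K * ∏ j, coshSymbol σ (hyperplanePoint ξ j)) :
    ∫⁻ ξ, ‖formIntegrand M (fun _ => f) ξ‖ₑ ≤
      ENNReal.ofReal (K * (2 * Real.pi) ^ (n + 1) *
        ‖multiplierOp (coshSymbol σ) f‖ ^ (n + 2)) := by
  set X := ‖multiplierOp (coshSymbol σ) f‖ with hX
  have hX0 : 0 ≤ X := norm_nonneg _
  have hpi : (0 : ℝ) < 2 * Real.pi := by positivity
  set G := weightedHat σ f with hG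
  set W : ℝ → ENNReal := fun ξ => ENNReal.ofReal (1 + |ξ|)⁻¹ * G ξ with hW
  have hGm : Measurable G := measurable_weightedHat σ f
  have hWm : Measurable W := by fun_prop
  have hpt : ∀ᵐ ξ : Fin (n + 1) → ℝ, ‖formIntegrand M (fun _ => f) ξ‖ₑ ≤
      ENNReal.ofReal K * ((∏ i : Fin n, W (ξ i.castSucc)) * G (ξ (Fin.last n)) *
        G (0 - ∑ i, ξ i)) := by
    filter_upwards [hM] with ξ hξ
    have hprod : 0 < ∏ i : Fin n, (1 + |ξ i.castSucc|) :=
      Finset.prod_pos fun i _ => by positivity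
    have hle : ‖M (hyperplanePoint ξ)‖ₑ ≤ ENNReal.ofReal K *
        ((∏ i : Fin n, ENNReal.ofReal (1 + |ξ i.castSucc|)⁻¹) *
          ∏ j, ENNReal.ofReal (coshSymbol σ (hyperplanePoint ξ j))) := by
      rw [← ENNReal.ofReal_prod_of_nonneg fun i _ => by positivity,
        ← ENNReal.ofReal_prod_of_nonneg
          fun j _ => show 0 ≤ coshSymbol σ (hyperplanePoint ξ j) from (Real.cosh_pos _).le,
        ← ENNReal.ofReal_mul (Finset.prod_nonneg fun i _ => by positivity),
        ← ENNReal.ofReal_mul hK, ← ofReal_norm]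
      refine ENNReal.ofReal_le_ofReal ?_
      rw [← le_div_iff₀ hprod] at hξ
      refine hξ.trans (le_of_eq ?_)
      rw [Finset.prod_inv_distrib, div_eq_mul_inv]
      ring
    have hGprod : (∏ j, ENNReal.ofReal (coshSymbol σ (hyperplanePoint ξ j))) *
        ∏ j, ‖hat f (hyperplanePoint ξ j)‖ₑ =
          (∏ i : Fin n, G (ξ i.castSucc)) * G (ξ (Fin.last n)) * G (0 - ∑ i, ξ i) := by
      rw [← Finset.prod_mul_distrib, Fin.prod_univ_castSucc, Fin.prod_univ_castSucc]
      simp only [hyperplanePoint_castSucc, hyperplanePoint_last, zero_sub]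
      rfl
    have hfin : ‖∏ j, hat f (hyperplanePoint ξ j)‖ₑ = ∏ j, ‖hat f (hyperplanePoint ξ j)‖ₑ := by
      simp only [← ofReal_norm, norm_prod]
      exact ENNReal.ofReal_prod_of_nonneg fun j _ => norm_nonneg _
    rw [formIntegrand, enorm_mul, hfin]
    calc _ ≤ (ENNReal.ofReal K * ((∏ i : Fin n, ENNReal.ofReal (1 + |ξ i.castSucc|)⁻¹) *
          ∏ j, ENNReal.ofReal (coshSymbol σ (hyperplanePoint ξ j)))) *
          ∏ j, ‖hat f (hyperplanePoint ξ j)‖ₑ := by gcongr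
      _ = ENNReal.ofReal K * ((∏ i : Fin n, ENNReal.ofReal (1 + |ξ i.castSucc|)⁻¹) *
          ((∏ j, ENNReal.ofReal (coshSymbol σ (hyperplanePoint ξ j))) *
          ∏ j, ‖hat f (hyperplanePoint ξ j)‖ₑ)) := by ring
      _ = _ := by
        rw [hGprod]
        simp only [hW, Finset.prod_mul_distrib]
        ring
  calc ∫⁻ ξ, ‖formIntegrand M (fun _ => f) ξ‖ₑ
      ≤ ∫⁻ ξ : Fin (n + 1) → ℝ, ENNReal.ofReal K * ((∏ i : Fin n, W (ξ i.castSucc)) *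
          G (ξ (Fin.last n)) * G (0 - ∑ i, ξ i)) := lintegral_mono_ae hpt
    _ ≤ ENNReal.ofReal K * ((∫⁻ x, W x) ^ n * ∫⁻ x, G x ^ 2) := by
        rw [lintegral_const_mul _ (by fun_prop)]
        gcongr
        exact lintegral_hyperplane_le hWm hGm n 0
    _ ≤ ENNReal.ofReal K * (ENNReal.ofReal (2 * Real.pi * X) ^ n *
          ENNReal.ofReal (2 * Real.pi * X ^ 2)) := by
        rw [hG, lintegral_weightedHat_sq hσ hf]
        gcongr
        exact lintegral_weightedHat_mul_le hσ hf
    _ = _ := by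
        rw [← ENNReal.ofReal_pow (by positivity), ← ENNReal.ofReal_mul (by positivity),
          ← ENNReal.ofReal_mul hK]
        congr 1
        ring

/-- A multiplier that gains `1 + |ξ|` in all variables but two defines a bounded form. -/
theorem integrable_and_norm_Lam_le {n : ℕ} {σ : ℝ} (hσ : 0 < σ)
    {f : Lp ℝ 2 (volume : Measure ℝ)} (hf : MemGevrey σ f) {M : (Fin (n + 2) → ℝ) → ℂ} {K : ℝ}
    (hK : 0 ≤ K) (hMm : Measurable M)
    (hM : ∀ᵐ ξ : Fin (n + 1) → ℝ,
      ‖M (hyperplanePoint ξ)‖ * ∏ i : Fin n, (1 + |ξ i.castSucc|) ≤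
        K * ∏ j, coshSymbol σ (hyperplanePoint ξ j)) :
    Integrable (formIntegrand M (fun _ => f)) ∧
      ‖Lam M (fun _ => f)‖ ≤ K * ‖multiplierOp (coshSymbol σ) f‖ ^ (n + 2) := by
  have h := lintegral_formIntegrand_le hσ hf hK hM
  refine ⟨⟨(measurable_formIntegrand hMm _).aestronglyMeasurable,
    lt_of_le_of_lt h ENNReal.ofReal_lt_top⟩, ?_⟩
  have hpi : (0 : ℝ) < 2 * Real.pi := by positivity
  have hint : ‖∫ ξ, formIntegrand M (fun _ => f) ξ‖ ≤ K * (2 * Real.pi) ^ (n + 1) *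
      ‖multiplierOp (coshSymbol σ) f‖ ^ (n + 2) := by
    have h2 := (enorm_integral_le_lintegral_enorm _).trans h
    rw [← ofReal_norm] at h2
    exact (ENNReal.ofReal_le_ofReal_iff (by positivity)).1 h2
  rw [Lam, norm_mul, norm_inv, Complex.norm_real, Real.norm_eq_abs,
    abs_of_pos (by positivity)]
  calc _ ≤ ((2 * Real.pi) ^ (n + 1))⁻¹ * (K * (2 * Real.pi) ^ (n + 1) *
      ‖multiplierOp (coshSymbol σ) f‖ ^ (n + 2)) := by gcongr
    _ = _ := by field_simp

theorem measurable_β₃ {m : ℝ → ℝ} (hm : Measurable m) : Measurable (β₃ m) := by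
  unfold β₃ M₃ alpha sym
  fun_prop

theorem measurable_β₄ {m : ℝ → ℝ} (hm : Measurable m) : Measurable (β₄ m) := by
  have h3 := measurable_β₃ hm
  have hvec : ∀ τ : Equiv.Perm (Fin 4), Measurable fun ξ : Fin 4 → ℝ =>
      (![ξ (τ 0), ξ (τ 1), ξ (τ 2) + ξ (τ 3)] : Fin 3 → ℝ) := by
    intro τ
    refine measurable_pi_iff.2 fun i => ?_
    fin_cases i <;> simp <;> fun_prop
  unfold β₄ M₄ alpha sym
  fun_prop

end KdVEnergy

theorem lemma4p1 :
    ∃ C : ℝ, 0 < C ∧ ∀ σ : ℝ, 0 < σ → σ ≤ 1 →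
      ∀ (u : ℝ → MeasureTheory.Lp ℝ 2 (MeasureTheory.volume : MeasureTheory.Measure ℝ)) (t : ℝ),
        KdVEnergy.MemGevrey σ (u t) →
          MeasureTheory.Integrable
            (KdVEnergy.formIntegrand (n := 2) (KdVEnergy.β₃ (KdVEnergy.coshSymbol σ))
              (fun _ => u t)) ∧
          MeasureTheory.Integrable
            (KdVEnergy.formIntegrand (n := 3) (KdVEnergy.β₄ (KdVEnergy.coshSymbol σ))
              (fun _ => u t)) ∧
          ‖KdVEnergy.energy₄ (KdVEnergy.coshSymbol σ) u t -
              (KdVEnergy.energy₂ (KdVEnergy.coshSymbol σ) u t : ℂ)‖ ≤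
            C * (‖KdVEnergy.multiplierOp (KdVEnergy.coshSymbol σ) (u t)‖ ^ 3 +
              ‖KdVEnergy.multiplierOp (KdVEnergy.coshSymbol σ) (u t)‖ ^ 4) := by
  open KdVEnergy in
  set K₃ : ℝ := 2 * (363 * Real.exp 12) with hK₃
  set K₄ : ℝ := 2 * ((4 * 57 * 36 * 19 ^ 3 + 3 * 19 ^ 4) * Real.exp 56) with hK₄
  have hK₃0 : 0 < K₃ := by positivity
  have hK₄0 : 0 < K₄ := by positivity
  refine ⟨K₃ + K₄, by positivity, fun σ hσ hσ1 u t hu => ?_⟩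
  have hm := measurable_coshSymbol σ
  obtain ⟨hi₃, hb₃⟩ := integrable_and_norm_Lam_le (n := 1) hσ hu hK₃0.le (measurable_β₃ hm) (by
    filter_upwards [ae_cubicGeneric] with ξ hξ
    have h0 : hyperplanePoint ξ 0 = ξ 0 := hyperplanePoint_castSucc ξ 0
    have h1 : hyperplanePoint ξ 1 = ξ 1 := hyperplanePoint_castSucc ξ 1
    have h2 : hyperplanePoint ξ 2 = -(ξ 0 + ξ 1) := by
      rw [← Fin.sum_univ_two]; exact hyperplanePoint_last ξ
    have h := norm_β₃_le hσ hσ1 (hyperplanePoint ξ) (by rw [h0, h1, h2]; ring)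
      (by rw [h0, h1, h2]; exact hξ)
    rw [h0] at h
    rw [Fin.prod_univ_one]
    exact h)
  obtain ⟨hi₄, hb₄⟩ := integrable_and_norm_Lam_le (n := 2) hσ hu hK₄0.le (measurable_β₄ hm) (by
    filter_upwards [ae_quarticGeneric] with ξ ⟨hξ, hne⟩
    have h0 : hyperplanePoint ξ 0 = ξ 0 := hyperplanePoint_castSucc ξ 0
    have h1 : hyperplanePoint ξ 1 = ξ 1 := hyperplanePoint_castSucc ξ 1
    have h2 : hyperplanePoint ξ 2 = ξ 2 := hyperplanePoint_castSucc ξ 2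
    have h3 : hyperplanePoint ξ 3 = -(ξ 0 + ξ 1 + ξ 2) := by
      rw [← Fin.sum_univ_three]; exact hyperplanePoint_last ξ
    have h := norm_β₄_le hσ hσ1 (hyperplanePoint ξ) (by rw [h0, h1, h2, h3]; ring)
      (by
        intro i
        fin_cases i
        · exact h0 ▸ hne 0
        · exact h1 ▸ hne 1
        · exact h2 ▸ hne 2
        · exact h3 ▸ hne 3)
      (by rw [h0, h1]; exact hne 4) (by rw [h0, h2]; exact hne 5) (by rw [h1, h2]; exact hne 6)
      (by rw [h0, h1, h2, h3]; exact hξ)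
    rw [h0, h1] at h
    rw [Fin.prod_univ_two]
    exact h)
  refine ⟨hi₃, hi₄, ?_⟩
  set X := ‖multiplierOp (coshSymbol σ) (u t)‖ with hX
  have hX0 : 0 ≤ X := norm_nonneg _
  have hE : energy₄ (coshSymbol σ) u t - (energy₂ (coshSymbol σ) u t : ℂ) =
      Lam (n := 2) (β₃ (coshSymbol σ)) (fun _ => u t) +
        Lam (n := 3) (β₄ (coshSymbol σ)) (fun _ => u t) := by
    rw [energy₄, energy₃]; ring
  rw [hE]
  refine (norm_add_le _ _).trans ((add_le_add hb₃ hb₄).trans ?_)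
  norm_num only
  have h3 : 0 ≤ K₄ * X ^ 3 := by positivity
  have h4 : 0 ≤ K₃ * X ^ 4 := by positivity
  linarith
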